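/- For $T>0$ consider the one-dimensional wave equation with two boundary controls $$y_{tt}-y_{xx}=0\ \text{ in }(0,T)\times(0,1),\qquad y(t,0)=u_0(t),\quad y(t,1)=u_1(t),\qquad (y,y_t)(0,\cdot)=(a,b),$$ where $u_0,u_1\in L^2(0,T)$ and $(a,b)\in L^2(0,1)\times H^{-1}(0,1)$. Solutions are understood by transposition: $(y,y_t)\in C^0([0,T];L^2(0,1)\times H^{-1}(0,1))$ takes the value $(a,b)$ at $t=0$ and, for every $s\in[0,T]$ and every smooth $\varphi(t,x)$ with $\varphi(t,0)=\varphi(t,1)=0$ for all $t$, $$\int_0^s\!\!\int_0^1 y(\varphi_{tt}-\varphi_{xx})\,dx\,dt=\Big[\int_0^1 y\,\varphi_t\,dx-\langle y_t,\varphi\rangle_{H^{-1},H^1_0}\Big]_{t=0}^{t=s}-\int_0^s\big(u_1(t)\varphi_x(t,1)-u_0(t)\varphi_x(t,0)\big)dt .$$ A pair $(u_0,u_1)$ steers $(a,b)$ to $(a',b')$ in time $T$ if the solution satisfies $(y(T,\cdot),y_t(T,\cdot))=(a',b')$. For given data $(a,b)$ and target $(a',b')$, let $T_{\min}$ be the infimum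 of the times $T>0$ for which some pair $u_0,u_1\in L^2(0,T)$ steers $(a,b)$ to $(a',b')$ in time $T$; let $T_{\min}^c$ be the infimum when one requires moreover $u_0,u_1\ge 0$ a.e., and $T_{\min}^s$ the infimum when one requires moreover $u_0,u_1\ge0$ a.e. and $y\ge 0$. Let $y_0^0\ge 0$ and $y_1^0\ge 0$ be real constants, and take the initial datum $(y_0^0,0)$ and the final target $(y_1^0,0)$. Then: 1. For every $T>1$, the functions $$u_0(t)=\begin{cases}y_0^0,& t\in[0,1),\\ (y_1^0-y_0^0)\frac{t-1}{T-1}+y_0^0,& t\in[1,T],\end{cases}\qquad u_1(t)=\begin{cases}(y_1^0-y_0^0)\frac{t}{T-1}+y_0^0,& t\in[0,T-1),\\ y_1^0,& t\in[T-1,T],\end{cases}$$ are nonnegative on $[0,T]$, the problem with these controls has a unique solution, and they steer $(y_0^0,0)$ to $(y_1^0,0)$ in time $T$. The solution $y$ has a continuous representative on $[0,T]\times[0,1]$, and $y(t,x)\ge0$ for all $(t,x)\in[0,T]\times[0,1]$. 2. If $y_0^0\ne y_1^0$, then $T_{\min}^s=T_{\min}^c=T_{\min}=1$. 3. In time $T=1$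 the problem with the constant nonnegative controls $\hat u_0\equiv y_0^0$ and $\hat u_1\equiv y_1^0$ has a unique solution, these controls steer $(y_0^0,0)$ to $(y_1^0,0)$ in time $1$, and the solution satisfies $y\ge0$ a.e. in $(0,1)\times(0,1)$. 4. For every $\lambda\in[0,1]$, the constant nonnegative controls $\hat u_\lambda^0\equiv(1-\lambda)y_0^0+\lambda y_1^0$ at $x=0$ and $\hat u_\lambda^1\equiv(1-\lambda)y_1^0+\lambda y_0^0$ at $x=1$ steer $(y_0^0,0)$ to $(y_1^0,0)$ in time $1$ (again with a unique solution). In particular, if $y_0^0\neq y_1^0$, the controls in the minimal time $1$ are not unique: there are two pairs of nonnegative controls, not equal a.e. on $(0,1)$, that steer $(y_0^0,0)$ to $(y_1^0,0)$ in time $1$ with nonnegative solutions. -/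

import Mathlib

open MeasureTheory Set Filter Topology
open scoped ContDiff

noncomputable section

namespace WaveControl

/-- Lebesgue measure on the interval `(0,1)`. -/
abbrev unitMeasure : Measure ℝ := volume.restrict (Ioo (0 : ℝ) 1)

/-- The space `L²(0,1)`. -/
abbrev L2 : Type := Lp ℝ 2 unitMeasure

/-- The space `L²(0,1) × L²(0,1)` with its Hilbert norm `(‖p‖² + ‖q‖²)^{1/2}`. -/
abbrev L2L2 : Type := WithLp 2 (L2 × L2)

/-- The pairs `(ψ, ψ')` with `ψ ∈ C_c^∞(0,1)`. -/
def testPairs : Set L2L2 :=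
  {p | ∃ ψ : ℝ → ℝ, ContDiff ℝ ∞ ψ ∧ HasCompactSupport ψ ∧ tsupport ψ ⊆ Ioo 0 1 ∧
    p.fst =ᵐ[unitMeasure] ψ ∧ p.snd =ᵐ[unitMeasure] deriv ψ}

/-- The Sobolev space `H¹₀(0,1)`: the closure of `C_c^∞(0,1)` for the norm
`(‖ψ‖² + ‖ψ'‖²)^{1/2}`; a function `v` is recorded as the pair `(v, v')`. -/
def H10 : Submodule ℝ L2L2 := (Submodule.span ℝ testPairs).topologicalClosure

/-- The space `H⁻¹(0,1)`: the dual of `H¹₀(0,1)`. -/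
abbrev HNegOne : Type := StrongDual ℝ H10

theorem memLp_of_continuous {f : ℝ → ℝ} (hf : Continuous f) : MemLp f 2 unitMeasure := by
  obtain ⟨C, hC⟩ := isCompact_Icc.exists_bound_of_continuousOn
    (s := Icc (0 : ℝ) 1) hf.continuousOn
  refine MemLp.of_bound hf.aestronglyMeasurable C ?_
  filter_upwards [ae_restrict_mem measurableSet_Ioo] with x hx
  exact hC x ⟨hx.1.le, hx.2.le⟩

/-- The class in `L²(0,1)` of a continuous function. -/
def ofContinuous (f : ℝ → ℝ) (hf : Continuous f) : L2 := (memLp_of_continuous hf).toLp f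

theorem tendsto_ofContinuous {f : ℕ → ℝ → ℝ} {g : ℝ → ℝ} (hf : ∀ n, Continuous (f n))
    (hg : Continuous g) (C : ℝ) (hC : ∀ n, ∀ x ∈ Ioo (0 : ℝ) 1, |f n x| ≤ C)
    (h : ∀ x ∈ Ioo (0 : ℝ) 1, Tendsto (fun n => f n x) atTop (𝓝 (g x))) :
    Tendsto (fun n => ofContinuous (f n) (hf n)) atTop (𝓝 (ofContinuous g hg)) := by
  refine (Lp.tendsto_Lp_iff_tendsto_eLpNorm'' f (fun n => memLp_of_continuous (hf n)) g
    (memLp_of_continuous hg)).2 ?_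
  refine tendsto_Lp_finite_of_tendsto_ae one_le_two (by simp)
    (fun n => (hf n).aestronglyMeasurable) (memLp_of_continuous hg) ?_ ?_
  · refine unifIntegrable_of one_le_two (by simp) (fun n => (hf n).aestronglyMeasurable) ?_
    intro ε _
    refine ⟨Real.toNNReal (|C| + 1), fun n => ?_⟩
    rw [eLpNorm_congr_ae (g := fun _ => (0 : ℝ))]
    · simp
    · filter_upwards [ae_restrict_mem measurableSet_Ioo] with x hx
      refine Set.indicator_of_notMem ?_ _
      intro hmem
      have h1 : (Real.toNNReal (|C| + 1) : ℝ) ≤ ‖f n x‖ := by exact_mod_cast hmem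
      rw [Real.coe_toNNReal _ (by positivity), Real.norm_eq_abs] at h1
      linarith [hC n x hx, le_abs_self C]
  · filter_upwards [ae_restrict_mem measurableSet_Ioo] with x hx using h x hx

/-- A smooth cut-off, equal to `1` on `[2/(n+1), 1 - 2/(n+1)]` and to `0` outside
`[1/(n+1), 1 - 1/(n+1)]`. -/
def cutoff (n : ℕ) (x : ℝ) : ℝ :=
  Real.smoothTransition ((n + 1) * x - 1) * Real.smoothTransition ((n + 1) * (1 - x) - 1)

theorem contDiff_cutoff (n : ℕ) : ContDiff ℝ ∞ (cutoff n) := by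
  have hS : ContDiff ℝ ∞ Real.smoothTransition := Real.smoothTransition.contDiff
  unfold cutoff
  exact (hS.comp (by fun_prop)).mul (hS.comp (by fun_prop))

theorem tsupport_cutoff_subset (n : ℕ) :
    tsupport (cutoff n) ⊆ Icc (1 / ((n : ℝ) + 1)) (1 - 1 / ((n : ℝ) + 1)) := by
  have hn : (0 : ℝ) < n + 1 := by positivity
  refine closure_minimal ?_ isClosed_Icc
  intro x hx
  have hx' : cutoff n x ≠ 0 := hx
  unfold cutoff at hx'
  have h1 : 0 < (n + 1) * x - 1 := by
    by_contra hc
    exact hx' (by rw [Real.smoothTransition.zero_of_nonpos (not_lt.1 hc), zero_mul])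
  have h2 : 0 < (n + 1) * (1 - x) - 1 := by
    by_contra hc
    exact hx' (by rw [Real.smoothTransition.zero_of_nonpos (not_lt.1 hc), mul_zero])
  constructor
  · rw [div_le_iff₀ hn]; linarith
  · rw [le_sub_comm, div_le_iff₀ hn]; linarith

theorem tsupport_cutoff_subset_Ioo (n : ℕ) : tsupport (cutoff n) ⊆ Ioo 0 1 := by
  have hn : (0 : ℝ) < 1 / ((n : ℝ) + 1) := by positivity
  intro x hx
  have := tsupport_cutoff_subset n hx
  exact ⟨lt_of_lt_of_le hn this.1, by linarith [this.2]⟩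

theorem cutoff_eventually_eq_one {x : ℝ} (hx : x ∈ Ioo (0 : ℝ) 1) :
    ∀ᶠ n : ℕ in atTop, cutoff n =ᶠ[𝓝 x] fun _ => 1 := by
  have hd : 0 < min x (1 - x) / 2 := by
    have := lt_min hx.1 (sub_pos.2 hx.2)
    positivity
  obtain ⟨N, hN⟩ := exists_nat_gt (2 / (min x (1 - x) / 2))
  filter_upwards [eventually_ge_atTop N] with n hn
  have hn' : (N : ℝ) ≤ n := by exact_mod_cast hn
  have h2 : 2 ≤ ((n : ℝ) + 1) * (min x (1 - x) / 2) := by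
    rw [div_lt_iff₀ hd] at hN
    nlinarith
  have hn0 : (0 : ℝ) < n + 1 := by positivity
  filter_upwards [Ioo_mem_nhds (show x - min x (1 - x) / 2 < x by linarith)
    (show x < x + min x (1 - x) / 2 by linarith)] with z hz
  have hz1 : min x (1 - x) / 2 ≤ z := by linarith [hz.1, min_le_left x (1 - x)]
  have hz2 : min x (1 - x) / 2 ≤ 1 - z := by linarith [hz.2, min_le_right x (1 - x)]
  unfold cutoff
  rw [Real.smoothTransition.one_of_one_le, Real.smoothTransition.one_of_one_le, one_mul]
  · nlinarith
  · nlinarith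

theorem exists_transition_bound :
    ∃ M : ℝ, 0 ≤ M ∧ ∀ z : ℝ, -1 ≤ z → (z + 1) * |deriv Real.smoothTransition z| ≤ M := by
  have hS : ContDiff ℝ ∞ Real.smoothTransition := Real.smoothTransition.contDiff
  have hc : Continuous (fun z : ℝ => (z + 1) * |deriv Real.smoothTransition z|) :=
    (by fun_prop : Continuous fun z : ℝ => z + 1).mul
      (hS.continuous_deriv (by simp)).abs
  obtain ⟨M, hM⟩ := isCompact_Icc.exists_bound_of_continuousOn
    (s := Icc (-1 : ℝ) 1) hc.continuousOn
  refine ⟨M, (norm_nonneg _).trans (hM 0 (by norm_num)), fun z hz => ?_⟩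
  rcases le_or_gt z 1 with h1 | h1
  · exact (le_abs_self _).trans (hM z ⟨hz, h1⟩)
  · have : Real.smoothTransition =ᶠ[𝓝 z] fun _ => 1 := by
      filter_upwards [Ioi_mem_nhds h1] with w hw
      exact Real.smoothTransition.one_of_one_le (le_of_lt hw)
    rw [this.deriv_eq]
    simpa using (norm_nonneg _).trans (hM 0 (by norm_num))

theorem hasDerivAt_cutoff (n : ℕ) (x : ℝ) :
    HasDerivAt (cutoff n)
      (deriv Real.smoothTransition ((n + 1) * x - 1) * (n + 1) *
          Real.smoothTransition ((n + 1) * (1 - x) - 1) +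
        Real.smoothTransition ((n + 1) * x - 1) *
          (deriv Real.smoothTransition ((n + 1) * (1 - x) - 1) * (-(n + 1)))) x := by
  have hS : ContDiff ℝ ∞ Real.smoothTransition := Real.smoothTransition.contDiff
  have hd : Differentiable ℝ Real.smoothTransition := hS.differentiable (by simp)
  have e1 : HasDerivAt (fun x : ℝ => ((n : ℝ) + 1) * x - 1) ((n : ℝ) + 1) x := by
    simpa using ((hasDerivAt_id x).const_mul ((n : ℝ) + 1)).sub_const 1
  have e2 : HasDerivAt (fun x : ℝ => ((n : ℝ) + 1) * (1 - x) - 1) (-((n : ℝ) + 1)) x := by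
    simpa using (((hasDerivAt_id x).const_sub 1).const_mul ((n : ℝ) + 1)).sub_const 1
  exact ((hd _).hasDerivAt.comp x e1).mul ((hd _).hasDerivAt.comp x e2)

theorem exists_cutoff_bound {f : ℝ → ℝ} (hf : ContDiff ℝ ∞ f) (h0 : f 0 = 0) (h1 : f 1 = 0) :
    ∃ C : ℝ, ∀ n : ℕ, ∀ x ∈ Ioo (0 : ℝ) 1,
      |cutoff n x * f x| ≤ C ∧ |deriv (fun z => cutoff n z * f z) x| ≤ C := by
  obtain ⟨M, hM0, hM⟩ := exists_transition_bound
  obtain ⟨L, hL⟩ := isCompact_Icc.exists_bound_of_continuousOn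
    (s := Icc (0 : ℝ) 1) (hf.continuous_deriv (by simp)).continuousOn
  have hL0 : 0 ≤ L := (norm_nonneg _).trans (hL 0 (by norm_num))
  have hdf : Differentiable ℝ f := hf.differentiable (by simp)
  have hlip : ∀ a ∈ Icc (0 : ℝ) 1, ∀ b ∈ Icc (0 : ℝ) 1, |f b - f a| ≤ L * |b - a| := by
    intro a ha b hb
    exact (convex_Icc (0 : ℝ) 1).norm_image_sub_le_of_norm_deriv_le
      (fun x _ => hdf x) hL ha hb
  refine ⟨L + 2 * (L * M), fun n x hx => ?_⟩
  have hn : (0 : ℝ) < n + 1 := by positivity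
  have hxI : x ∈ Icc (0 : ℝ) 1 := ⟨hx.1.le, hx.2.le⟩
  have hb0 : |f x| ≤ L * x := by
    simpa [h0, abs_of_pos hx.1] using hlip 0 (by norm_num) x hxI
  have hb1 : |f x| ≤ L * (1 - x) := by
    have := hlip 1 (by norm_num) x hxI
    rwa [h1, sub_zero, abs_sub_comm x 1, abs_of_pos (sub_pos.2 hx.2)] at this
  set s := Real.smoothTransition ((n + 1) * x - 1) with hs
  set r := Real.smoothTransition ((n + 1) * (1 - x) - 1) with hr
  have hs0 : 0 ≤ s := Real.smoothTransition.nonneg _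
  have hs1 : s ≤ 1 := Real.smoothTransition.le_one _
  have hr0 : 0 ≤ r := Real.smoothTransition.nonneg _
  have hr1 : r ≤ 1 := Real.smoothTransition.le_one _
  have hc : cutoff n x = s * r := rfl
  have hsr0 : 0 ≤ s * r := mul_nonneg hs0 hr0
  have hsr1 : s * r ≤ 1 := mul_le_one₀ hs1 hr0 hr1
  have hLM : 0 ≤ L * M := mul_nonneg hL0 hM0
  constructor
  · rw [hc, abs_mul, abs_of_nonneg hsr0]
    have : |f x| ≤ L := hb0.trans (by nlinarith [hx.2])
    nlinarith [abs_nonneg (f x)]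
  · have hD := (hasDerivAt_cutoff n x).mul (hdf x).hasDerivAt
    rw [show deriv (fun z => cutoff n z * f z) x = _ from hD.deriv, ← hs, ← hr, hc]
    set p := deriv Real.smoothTransition ((n + 1) * x - 1) with hp
    set q := deriv Real.smoothTransition ((n + 1) * (1 - x) - 1) with hq
    have hp1 : (n + 1) * x * |p| ≤ M := by
      have := hM ((n + 1) * x - 1) (by nlinarith [hx.1])
      simpa using this
    have hq1 : (n + 1) * (1 - x) * |q| ≤ M := by
      have := hM ((n + 1) * (1 - x) - 1) (by nlinarith [hx.2])
      simpa using this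
    have hA : |p * (n + 1) * r * f x| ≤ L * M := by
      rw [abs_mul, abs_mul, abs_mul, abs_of_pos hn, abs_of_nonneg hr0]
      calc |p| * (n + 1) * r * |f x| ≤ |p| * (n + 1) * 1 * (L * x) := by gcongr
        _ = L * ((n + 1) * x * |p|) := by ring
        _ ≤ L * M := by gcongr
    have hB : |s * (q * (-(n + 1))) * f x| ≤ L * M := by
      rw [abs_mul, abs_mul, abs_mul, abs_neg, abs_of_pos hn, abs_of_nonneg hs0]
      calc s * (|q| * (n + 1)) * |f x| ≤ 1 * (|q| * (n + 1)) * (L * (1 - x)) := by gcongr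
        _ = L * ((n + 1) * (1 - x) * |q|) := by ring
        _ ≤ L * M := by gcongr
    have hE : |s * r * deriv f x| ≤ L := by
      rw [abs_mul, abs_of_nonneg hsr0]
      have := hL x hxI
      rw [Real.norm_eq_abs] at this
      nlinarith [abs_nonneg (deriv f x)]
    rw [add_mul]
    have t1 := abs_add_le (p * (n + 1) * r * f x + s * (q * (-(n + 1))) * f x)
      (s * r * deriv f x)
    have t2 := abs_add_le (p * (n + 1) * r * f x) (s * (q * (-(n + 1))) * f x)
    linarith

/-- A smooth function that vanishes at `0` and `1` belongs to `H¹₀(0,1)`. -/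
theorem smooth_mem_H10 {f : ℝ → ℝ} (hf : ContDiff ℝ ∞ f) (h0 : f 0 = 0) (h1 : f 1 = 0) :
    (WithLp.toLp 2 (ofContinuous f hf.continuous,
      ofContinuous (deriv f) (hf.continuous_deriv (by simp))) : L2L2) ∈ H10 := by
  obtain ⟨C, hC⟩ := exists_cutoff_bound hf h0 h1
  have hg : ∀ n : ℕ, ContDiff ℝ ∞ (fun z => cutoff n z * f z) :=
    fun n => (contDiff_cutoff n).mul hf
  have hev : ∀ x ∈ Ioo (0 : ℝ) 1, ∀ᶠ n : ℕ in atTop,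
      (fun z => cutoff n z * f z) =ᶠ[𝓝 x] f := by
    intro x hx
    filter_upwards [cutoff_eventually_eq_one hx] with n hn
    filter_upwards [hn] with z hz
    rw [hz, one_mul]
  have l1 := tendsto_ofContinuous (fun n => (hg n).continuous) hf.continuous C
    (fun n x hx => (hC n x hx).1) (fun x hx => tendsto_const_nhds.congr' (by
      filter_upwards [hev x hx] with n hn using hn.eq_of_nhds.symm))
  have l2 := tendsto_ofContinuous (fun n => (hg n).continuous_deriv (by simp))
    (hf.continuous_deriv (by simp)) C
    (fun n x hx => (hC n x hx).2) (fun x hx => tendsto_const_nhds.congr' (by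
      filter_upwards [hev x hx] with n hn using hn.deriv_eq.symm))
  have l3 := ((WithLp.prodContinuousLinearEquiv 2 ℝ L2 L2).symm.continuous.tendsto _).comp
    (l1.prodMk_nhds l2)
  refine mem_closure_of_tendsto l3 (Eventually.of_forall fun n => Submodule.subset_span ?_)
  have hsub : tsupport (fun z => cutoff n z * f z) ⊆ tsupport (cutoff n) :=
    tsupport_mul_subset_left
  refine ⟨fun z => cutoff n z * f z, hg n, ?_, hsub.trans (tsupport_cutoff_subset_Ioo n),
    MemLp.coeFn_toLp (memLp_of_continuous (hg n).continuous),
    MemLp.coeFn_toLp (memLp_of_continuous ((hg n).continuous_deriv (by simp)))⟩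
  exact isCompact_Icc.of_isClosed_subset (isClosed_tsupport _)
    (hsub.trans (tsupport_cutoff_subset n))

/-- The element of `H¹₀(0,1)` given by a smooth function that vanishes at `0` and `1`. -/
def toH10 (f : ℝ → ℝ) (hf : ContDiff ℝ ∞ f) (h0 : f 0 = 0) (h1 : f 1 = 0) : H10 :=
  ⟨WithLp.toLp 2 (ofContinuous f hf.continuous,
    ofContinuous (deriv f) (hf.continuous_deriv (by simp))), smooth_mem_H10 hf h0 h1⟩

/-- Test functions for the transposition formula: smooth functions `φ(t,x)` with
`φ(t,0) = φ(t,1) = 0` for all `t`. -/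
structure TestFunction where
  toFun : ℝ → ℝ → ℝ
  smooth : ContDiff ℝ ∞ (fun p : ℝ × ℝ => toFun p.1 p.2)
  left : ∀ t, toFun t 0 = 0
  right : ∀ t, toFun t 1 = 0

namespace TestFunction

/-- `φ(t,·)` as an element of `H¹₀(0,1)`. -/
def slice (φ : TestFunction) (t : ℝ) : H10 :=
  toH10 (φ.toFun t) (φ.smooth.comp (contDiff_const.prodMk contDiff_id)) (φ.left t) (φ.right t)

/-- `φ_t(t,x)`. -/
def dt (φ : TestFunction) (t x : ℝ) : ℝ := deriv (fun r => φ.toFun r x) t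

/-- `φ_x(t,x)`. -/
def dx (φ : TestFunction) (t x : ℝ) : ℝ := deriv (fun z => φ.toFun t z) x

/-- `φ_tt(t,x) - φ_xx(t,x)`. -/
def box (φ : TestFunction) (t x : ℝ) : ℝ :=
  deriv (fun r => φ.dt r x) t - deriv (fun z => φ.dx t z) x

end TestFunction

/-- `(y, v) = (y, y_t) ∈ C⁰([0,T]; L²(0,1) × H⁻¹(0,1))` is a solution by transposition of
`y_tt - y_xx = 0` in `(0,T) × (0,1)`, `y(t,0) = u₀(t)`, `y(t,1) = u₁(t)`,
`(y, y_t)(0) = (a, b)`. The formula is what two integrations by parts give for the product of the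
equation with a test function on `(0,s) × (0,1)`. -/
structure IsSolution (T : ℝ) (a : L2) (b : HNegOne) (u₀ u₁ : ℝ → ℝ)
    (y : ℝ → L2) (v : ℝ → HNegOne) : Prop where
  memLp_left : MemLp u₀ 2 (volume.restrict (Ioo 0 T))
  memLp_right : MemLp u₁ 2 (volume.restrict (Ioo 0 T))
  continuousOn_state : ContinuousOn y (Icc 0 T)
  continuousOn_velocity : ContinuousOn v (Icc 0 T)
  initial_state : y 0 = a
  initial_velocity : v 0 = b
  transposition : ∀ φ : TestFunction, ∀ s ∈ Icc 0 T,
    (∫ t in (0 : ℝ)..s, ∫ x, y t x * φ.box t x ∂unitMeasure) =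
      ((∫ x, y s x * φ.dt s x ∂unitMeasure) - v s (φ.slice s))
        - ((∫ x, y 0 x * φ.dt 0 x ∂unitMeasure) - v 0 (φ.slice 0))
        - ∫ t in (0 : ℝ)..s, (u₁ t * φ.dx t 1 - u₀ t * φ.dx t 0)

/-- `(y, v)` is the unique solution (on the time interval `[0,T]`). -/
def IsUniqueSolution (T : ℝ) (a : L2) (b : HNegOne) (u₀ u₁ : ℝ → ℝ)
    (y : ℝ → L2) (v : ℝ → HNegOne) : Prop :=
  IsSolution T a b u₀ u₁ y v ∧
    ∀ y' v', IsSolution T a b u₀ u₁ y' v' → EqOn y' y (Icc 0 T) ∧ EqOn v' v (Icc 0 T)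

/-- The control is nonnegative almost everywhere in `(0,T)`. -/
def NonnegControl (T : ℝ) (u : ℝ → ℝ) : Prop := ∀ᵐ t ∂(volume.restrict (Ioo 0 T)), 0 ≤ u t

/-- The state is nonnegative: for every `t ∈ [0,T]`, `y(t,x) ≥ 0` for almost every `x ∈ (0,1)`. -/
def NonnegState (T : ℝ) (y : ℝ → L2) : Prop :=
  ∀ t ∈ Icc 0 T, ∀ᵐ x ∂unitMeasure, 0 ≤ y t x

/-- The minimal controllability time from `(a, b)` to `(a', b')`, without constraints. -/
def minTime (a : L2) (b : HNegOne) (a' : L2) (b' : HNegOne) : ℝ :=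
  sInf {T | 0 < T ∧ ∃ u₀ u₁ y v, IsSolution T a b u₀ u₁ y v ∧ y T = a' ∧ v T = b'}

/-- The minimal controllability time with nonnegative controls. -/
def minTimeControl (a : L2) (b : HNegOne) (a' : L2) (b' : HNegOne) : ℝ :=
  sInf {T | 0 < T ∧ ∃ u₀ u₁ y v, NonnegControl T u₀ ∧ NonnegControl T u₁ ∧
    IsSolution T a b u₀ u₁ y v ∧ y T = a' ∧ v T = b'}

/-- The minimal controllability time with nonnegative controls and nonnegative state. -/
def minTimeState (a : L2) (b : HNegOne) (a' : L2) (b' : HNegOne) : ℝ :=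
  sInf {T | 0 < T ∧ ∃ u₀ u₁ y v, NonnegControl T u₀ ∧ NonnegControl T u₁ ∧
    IsSolution T a b u₀ u₁ y v ∧ y T = a' ∧ v T = b' ∧ NonnegState T y}

/-- The constant function `c` in `L²(0,1)`. -/
def constState (c : ℝ) : L2 := Lp.const 2 unitMeasure c

/-- The control at `x = 0` for `T > 1`: equal to `c₀` on `[0,1)`, then affine from `c₀` to `c₁`. -/
def ramp₀ (T c₀ c₁ t : ℝ) : ℝ := if t < 1 then c₀ else (c₁ - c₀) * ((t - 1) / (T - 1)) + c₀

/-- The control at `x = 1` for `T > 1`: affine from `c₀` to `c₁` on `[0,T-1)`, then equal to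
`c₁`. -/
def ramp₁ (T c₀ c₁ t : ℝ) : ℝ := if t < T - 1 then (c₁ - c₀) * (t / (T - 1)) + c₀ else c₁

end WaveControl

end

open MeasureTheory Set Filter Topology
open scoped ContDiff

noncomputable section

namespace WaveControl

/-! ### Calculus of test functions -/

/-! Existence is d'Alembert's formula: `p(t + x) + q(t + 1 - x)` solves the wave equation, and its
traces at `x = 0` and `x = 1` are the controls. Its velocity is the weak `x`-derivative of `p(t + x)
- q(t + 1 - x)`, so the solution is at rest as soon as both profiles are constant on the window `(t,
t + 1)`. For `T > 1` one continuous left-going wave suffices: `q = 0` and `p` rises or falls from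
`c₀` to `c₁` on `[1, T]`. For `T = 1` both profiles jump at `1`, and the free splitting `c = (1 - l)
c + l c` between the two directions produces the family of controls. Signs are read off from `p` and
`q`.

The transposition formula for `p(t + x)` (`TransportIdentity`) follows from the divergence theorem
when `p` is smooth. Both sides are integrals of `p` against continuous kernels, so it passes to
bounded pointwise limits (`TransportIdentity.of_tendsto`), first to continuous profiles and then to
steps. The right-going wave is obtained by reflection, and `IsProfile.isSolution` adds the two.

The lower bound and uniqueness are duality arguments with the explicit test functions `A(t + x) -
A(t - x)`, `A` of period `2`, which are annihilated by the wave operator. If `A` is locally flat to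
first order on `[0, T]` and on `[1, 1 + T]`, their normal derivatives vanish on both sides and the
controls are invisible. For `T < 1` these intervals are disjoint modulo `2`, so `A` can be `0` on
one and `1` on the other, and the formula then forces `c₀ = c₁` (`eq_of_steers_of_lt_one`). For
uniqueness, `A` is chosen so that the test function vanishes at time `s` with prescribed time
derivative, which determines `y s`; time-independent test functions then determine `v s`. -/

theorem hasDerivAt_fst {G : ℝ × ℝ → ℝ} {t x : ℝ} (hG : DifferentiableAt ℝ G (t, x)) :
    HasDerivAt (fun r => G (r, x)) (fderiv ℝ G (t, x) (1, 0)) t :=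
  hG.hasFDerivAt.comp_hasDerivAt t ((hasDerivAt_id t).prodMk (hasDerivAt_const t x))

theorem hasDerivAt_snd {G : ℝ × ℝ → ℝ} {t x : ℝ} (hG : DifferentiableAt ℝ G (t, x)) :
    HasDerivAt (fun z => G (t, z)) (fderiv ℝ G (t, x) (0, 1)) x :=
  hG.hasFDerivAt.comp_hasDerivAt x ((hasDerivAt_const x t).prodMk (hasDerivAt_id x))

theorem contDiff_fderiv_apply {G : ℝ × ℝ → ℝ} (hG : ContDiff ℝ ∞ G) (e : ℝ × ℝ) :
    ContDiff ℝ ∞ (fun p => fderiv ℝ G p e) :=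
  (hG.fderiv_right (m := ∞) (by simp)).clm_apply contDiff_const

namespace TestFunction

variable (φ : TestFunction)

theorem dt_eq (t x : ℝ) :
    φ.dt t x = fderiv ℝ (fun p : ℝ × ℝ => φ.toFun p.1 p.2) (t, x) (1, 0) :=
  (hasDerivAt_fst (φ.smooth.differentiable (by simp) (t, x))).deriv

theorem dx_eq (t x : ℝ) :
    φ.dx t x = fderiv ℝ (fun p : ℝ × ℝ => φ.toFun p.1 p.2) (t, x) (0, 1) :=
  (hasDerivAt_snd (φ.smooth.differentiable (by simp) (t, x))).deriv

theorem contDiff_dt : ContDiff ℝ ∞ (fun p : ℝ × ℝ => φ.dt p.1 p.2) := by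
  simp only [dt_eq]
  exact contDiff_fderiv_apply φ.smooth _

theorem contDiff_dx : ContDiff ℝ ∞ (fun p : ℝ × ℝ => φ.dx p.1 p.2) := by
  simp only [dx_eq]
  exact contDiff_fderiv_apply φ.smooth _

theorem continuous_dt (t : ℝ) : Continuous (φ.dt t) :=
  φ.contDiff_dt.continuous.comp (by fun_prop : Continuous fun x : ℝ => (t, x))

theorem continuous_dx (t : ℝ) : Continuous (φ.dx t) :=
  φ.contDiff_dx.continuous.comp (by fun_prop : Continuous fun x : ℝ => (t, x))

theorem box_eq_fderiv (t x : ℝ) :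
    φ.box t x = fderiv ℝ (fun p : ℝ × ℝ => φ.dt p.1 p.2) (t, x) (1, 0)
      - fderiv ℝ (fun p : ℝ × ℝ => φ.dx p.1 p.2) (t, x) (0, 1) := by
  unfold box
  rw [(hasDerivAt_fst (φ.contDiff_dt.differentiable (by simp) (t, x))).deriv,
    (hasDerivAt_snd (φ.contDiff_dx.differentiable (by simp) (t, x))).deriv]

theorem continuous_box : Continuous (fun p : ℝ × ℝ => φ.box p.1 p.2) := by
  simp only [box_eq_fderiv]
  exact (contDiff_fderiv_apply φ.contDiff_dt _).continuous.sub
    (contDiff_fderiv_apply φ.contDiff_dx _).continuous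

/-- The mixed second derivatives agree: `φ_tx = φ_xt`. -/
theorem fderiv_dt_snd (p : ℝ × ℝ) :
    fderiv ℝ (fun p : ℝ × ℝ => φ.dt p.1 p.2) p (0, 1) =
      fderiv ℝ (fun p : ℝ × ℝ => φ.dx p.1 p.2) p (1, 0) := by
  have hs : IsSymmSndFDerivAt ℝ (fun p : ℝ × ℝ => φ.toFun p.1 p.2) p :=
    φ.smooth.contDiffAt.isSymmSndFDerivAt (by
      rw [minSmoothness_of_isRCLikeNormedField]
      exact WithTop.coe_le_coe.2 (le_top : (2 : ℕ∞) ≤ ⊤))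
  have hd : DifferentiableAt ℝ (fderiv ℝ (fun p : ℝ × ℝ => φ.toFun p.1 p.2)) p :=
    (φ.smooth.fderiv_right (m := ∞) (by simp)).differentiable (by simp) p
  simp only [dt_eq, dx_eq]
  rw [fderiv_clm_apply hd (by fun_prop), fderiv_clm_apply hd (by fun_prop)]
  simpa using hs (0, 1) (1, 0)

theorem dt_left (t : ℝ) : φ.dt t 0 = 0 := by simp [dt, φ.left]

theorem dt_right (t : ℝ) : φ.dt t 1 = 0 := by simp [dt, φ.right]

/-- The reflected test function `φ(t, 1 - x)`. -/
def reflect : TestFunction where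
  toFun t x := φ.toFun t (1 - x)
  smooth := φ.smooth.comp (by fun_prop : ContDiff ℝ ∞ fun p : ℝ × ℝ => (p.1, 1 - p.2))
  left t := by simp [φ.right]
  right t := by simp [φ.left]

theorem reflect_dt (t x : ℝ) : φ.reflect.dt t x = φ.dt t (1 - x) := rfl

theorem reflect_dx (t x : ℝ) : φ.reflect.dx t x = -φ.dx t (1 - x) := by
  unfold dx reflect
  exact deriv_comp_const_sub (f := φ.toFun t) 1 x

theorem reflect_box (t x : ℝ) : φ.reflect.box t x = φ.box t (1 - x) := by
  unfold box
  simp only [reflect_dt, reflect_dx]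
  rw [deriv.fun_neg, deriv_comp_const_sub (f := φ.dx t) 1 x, neg_neg]

/-- The test function `A(t + x) - A(t - x)` given by a smooth function `A` of period `2`. -/
def ofPeriodic (A : ℝ → ℝ) (hA : ContDiff ℝ ∞ A) (hp : Function.Periodic A 2) :
    TestFunction where
  toFun t x := A (t + x) - A (t - x)
  smooth := (hA.comp (by fun_prop)).sub (hA.comp (by fun_prop))
  left t := by simp
  right t := by
    have := hp (t - 1)
    rw [show t - 1 + 2 = t + 1 by ring] at this
    rw [this, sub_self]

section ofPeriodic

variable {A : ℝ → ℝ} (hA : ContDiff ℝ ∞ A) (hp : Function.Periodic A 2)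

theorem ofPeriodic_dt (t x : ℝ) :
    (ofPeriodic A hA hp).dt t x = deriv A (t + x) - deriv A (t - x) := by
  have hd : Differentiable ℝ A := hA.differentiable (by simp)
  exact (((hd _).hasDerivAt.comp_add_const t x).sub
    ((hd _).hasDerivAt.comp_sub_const t x)).deriv

theorem ofPeriodic_dx (t x : ℝ) :
    (ofPeriodic A hA hp).dx t x = deriv A (t + x) + deriv A (t - x) := by
  have hd : Differentiable ℝ A := hA.differentiable (by simp)
  have := (((hd _).hasDerivAt.comp_const_add t x).sub
    ((hd _).hasDerivAt.comp_const_sub t x)).deriv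
  rw [sub_neg_eq_add] at this
  exact this

theorem ofPeriodic_box (t x : ℝ) : (ofPeriodic A hA hp).box t x = 0 := by
  have hd : Differentiable ℝ (deriv A) :=
    ((contDiff_infty_iff_deriv (𝕜 := ℝ)).1 hA).2.differentiable (by simp)
  unfold box
  simp only [ofPeriodic_dt, ofPeriodic_dx]
  rw [(((hd _).hasDerivAt.comp_add_const t x).fun_sub
    ((hd _).hasDerivAt.comp_sub_const t x)).deriv,
    (((hd _).hasDerivAt.comp_const_add t x).fun_add
    ((hd _).hasDerivAt.comp_const_sub t x)).deriv]
  ring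

end ofPeriodic

end TestFunction

theorem integral_unitMeasure (f : ℝ → ℝ) : ∫ x, f x ∂unitMeasure = ∫ x in (0 : ℝ)..1, f x := by
  rw [intervalIntegral.integral_of_le zero_le_one, integral_Ioc_eq_integral_Ioo]

theorem toH10_fst_ae {f : ℝ → ℝ} (hf : ContDiff ℝ ∞ f) (h0 : f 0 = 0) (h1 : f 1 = 0) :
    (toH10 f hf h0 h1 : L2L2).fst =ᵐ[unitMeasure] f :=
  MemLp.coeFn_toLp (memLp_of_continuous hf.continuous)

theorem toH10_snd_ae {f : ℝ → ℝ} (hf : ContDiff ℝ ∞ f) (h0 : f 0 = 0) (h1 : f 1 = 0) :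
    (toH10 f hf h0 h1 : L2L2).snd =ᵐ[unitMeasure] deriv f :=
  MemLp.coeFn_toLp (memLp_of_continuous (hf.continuous_deriv (by simp)))

theorem constState_ae (c : ℝ) : constState c =ᵐ[unitMeasure] fun _ => c :=
  Lp.coeFn_const (p := 2) (μ := unitMeasure) c

/-! ### Lower bound for the controllability time -/

/-- A smooth function of period `2`, equal to `0` on `[0,T]` and to `1` on `[1,1+T]` when
`0 < T < 1`. -/
def plateau (T z : ℝ) : ℝ :=
  Real.smoothTransition ((Real.cos (Real.pi * (T / 2)) - Real.cos (Real.pi * (z - T / 2))) /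
    (2 * Real.cos (Real.pi * (T / 2))))

theorem contDiff_plateau (T : ℝ) : ContDiff ℝ ∞ (plateau T) := by
  have hS : ContDiff ℝ ∞ Real.smoothTransition := Real.smoothTransition.contDiff
  unfold plateau
  refine hS.comp ?_
  have : ContDiff ℝ ∞ fun z : ℝ => Real.cos (Real.pi * (z - T / 2)) :=
    Real.contDiff_cos.comp (by fun_prop)
  exact (contDiff_const.sub this).div_const _

theorem periodic_plateau (T : ℝ) : Function.Periodic (plateau T) 2 := by
  intro z
  unfold plateau
  rw [show Real.pi * (z + 2 - T / 2) = Real.pi * (z - T / 2) + 2 * Real.pi by ring,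
    Real.cos_add_two_pi]

/-- The condition `T < 1` enters here: the argument stays below `π / 2`, so the normalising factor
in `plateau` is positive. -/
theorem cos_half_pos {T : ℝ} (h0 : 0 < T) (h1 : T < 1) : 0 < Real.cos (Real.pi * (T / 2)) :=
  Real.cos_pos_of_mem_Ioo ⟨by nlinarith [Real.pi_pos], by nlinarith [Real.pi_pos]⟩

theorem cos_half_le {T : ℝ} (h0 : 0 < T) (h1 : T < 1) {z : ℝ} (hz : z ∈ Icc 0 T) :
    Real.cos (Real.pi * (T / 2)) ≤ Real.cos (Real.pi * (z - T / 2)) := by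
  have hpi := Real.pi_pos
  rw [← Real.cos_abs (Real.pi * (z - T / 2))]
  refine Real.cos_le_cos_of_nonneg_of_le_pi (abs_nonneg _) (by nlinarith) ?_
  rw [abs_le]
  constructor <;> nlinarith [hz.1, hz.2]

theorem plateau_eq_zero {T : ℝ} (h0 : 0 < T) (h1 : T < 1)
    {z : ℝ} (hz : z ∈ Icc 0 T) : plateau T z = 0 := by
  refine Real.smoothTransition.zero_of_nonpos (div_nonpos_of_nonpos_of_nonneg ?_ ?_)
  · linarith [cos_half_le h0 h1 hz]
  · linarith [cos_half_pos h0 h1]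

/-- A shift by `1` reverses the sign of the cosine, so the numerator becomes a sum of two terms,
each at least `cos (π T / 2)`, and the quotient is at least `1`. -/
theorem plateau_add_one {T : ℝ} (h0 : 0 < T) (h1 : T < 1)
    {z : ℝ} (hz : z ∈ Icc 0 T) : plateau T (z + 1) = 1 := by
  refine Real.smoothTransition.one_of_one_le ?_
  rw [show Real.pi * (z + 1 - T / 2) = Real.pi * (z - T / 2) + Real.pi by ring, Real.cos_add_pi,
    le_div_iff₀ (by linarith [cos_half_pos h0 h1])]
  linarith [cos_half_le h0 h1 hz]

/-- The value `0` is a global minimum of `plateau T`; this kills the derivative at the endpoints `0`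
and `T` too, where local constancy is not known. -/
theorem deriv_plateau_eq_zero {T : ℝ} (h0 : 0 < T) (h1 : T < 1)
    {z : ℝ} (hz : z ∈ Icc 0 T) : deriv (plateau T) z = 0 := by
  refine IsLocalMin.deriv_eq_zero (Eventually.of_forall fun w => ?_)
  rw [plateau_eq_zero h0 h1 hz]
  exact Real.smoothTransition.nonneg _

theorem deriv_plateau_add_one {T : ℝ} (h0 : 0 < T) (h1 : T < 1)
    {z : ℝ} (hz : z ∈ Icc 0 T) : deriv (plateau T) (z + 1) = 0 := by
  refine IsLocalMax.deriv_eq_zero (Eventually.of_forall fun w => ?_)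
  rw [plateau_add_one h0 h1 hz]
  exact Real.smoothTransition.le_one _

theorem deriv_periodic {A : ℝ → ℝ} (hp : Function.Periodic A 2) :
    Function.Periodic (deriv A) 2 := by
  intro z
  rw [← deriv_comp_add_const]
  exact congrArg (deriv · z) (funext hp)

/-- The time derivative `A'(t + x) - A'(t - x)` is also the `x`-derivative of `A(t + x) + A(t - x)`,
and `A(t - 1) = A(t + 1)`. -/
theorem integral_dt_ofPeriodic {A : ℝ → ℝ} (hA : ContDiff ℝ ∞ A) (hp : Function.Periodic A 2)
    {y : L2} {c : ℝ} (hy : y = constState c) (t : ℝ) :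
    ∫ x, y x * (TestFunction.ofPeriodic A hA hp).dt t x ∂unitMeasure =
      2 * c * (A (t + 1) - A t) := by
  subst hy
  have hd : Differentiable ℝ A := hA.differentiable (by simp)
  have hc : Continuous (deriv A) := hA.continuous_deriv (by simp)
  have e : ∫ x, constState c x * (TestFunction.ofPeriodic A hA hp).dt t x ∂unitMeasure =
      ∫ x, c * (deriv A (t + x) - deriv A (t - x)) ∂unitMeasure := by
    refine integral_congr_ae ?_
    filter_upwards [constState_ae c] with x hx
    rw [hx, TestFunction.ofPeriodic_dt]
  rw [e, integral_unitMeasure, intervalIntegral.integral_const_mul,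
    intervalIntegral.integral_eq_sub_of_hasDerivAt (f := fun x => A (t + x) + A (t - x))
      (fun x _ => by
        simpa [sub_eq_add_neg] using ((hd _).hasDerivAt.comp_const_add t x).fun_add
          ((hd _).hasDerivAt.comp_const_sub t x))
      (Continuous.intervalIntegrable (by fun_prop) _ _)]
  have := hp (t - 1)
  rw [show t - 1 + 2 = t + 1 by ring] at this
  simp only [add_zero, sub_zero, ← this]
  ring

/-- In a time `T < 1` a constant state at rest can only be steered to itself. -/
theorem eq_of_steers_of_lt_one {T c₀ c₁ : ℝ} (hT0 : 0 < T) (hT1 : T < 1) {u₀ u₁ : ℝ → ℝ}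
    {y : ℝ → L2} {v : ℝ → HNegOne} (h : IsSolution T (constState c₀) 0 u₀ u₁ y v)
    (hy : y T = constState c₁) (hv : v T = 0) : c₀ = c₁ := by
  have hp := periodic_plateau T
  have hA := contDiff_plateau T
  have key := h.transposition (TestFunction.ofPeriodic (plateau T) hA hp) T ⟨hT0.le, le_rfl⟩
  -- The normal derivatives are `2 A'(t)` at `x = 0` and, by periodicity, `2 A'(t + 1)` at `x = 1`.
  -- Both vanish on `[0, T]`, so no control contributes.
  have hb : ∫ t in (0 : ℝ)..T, (u₁ t * (TestFunction.ofPeriodic (plateau T) hA hp).dx t 1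
      - u₀ t * (TestFunction.ofPeriodic (plateau T) hA hp).dx t 0) = 0 := by
    rw [intervalIntegral.integral_congr (g := fun _ => 0)]
    · simp
    · intro t ht
      rw [uIcc_of_le hT0.le] at ht
      have e1 := deriv_plateau_add_one hT0 hT1 ht
      have e2 := deriv_periodic hp (t - 1)
      rw [show t - 1 + 2 = t + 1 by ring, e1] at e2
      simp [TestFunction.ofPeriodic_dx, deriv_plateau_eq_zero hT0 hT1 ht, e1, ← e2]
  -- `A(t + 1) - A(t) = 1` at `t = 0` and at `t = T`, so the identity reduces to `0 = 2 c₁ - 2 c₀`.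
  rw [hb, hv, h.initial_velocity, integral_dt_ofPeriodic hA hp hy,
    integral_dt_ofPeriodic hA hp h.initial_state, plateau_add_one hT0 hT1 ⟨hT0.le, le_rfl⟩,
    plateau_eq_zero hT0 hT1 ⟨hT0.le, le_rfl⟩, plateau_add_one hT0 hT1 ⟨le_rfl, hT0.le⟩,
    plateau_eq_zero hT0 hT1 ⟨le_rfl, hT0.le⟩] at key
  simp only [TestFunction.ofPeriodic_box] at key
  simp at key
  linarith

/-! ### Uniqueness of solutions -/

/-- A smooth even function of period `2` whose derivative is `ψ` on `(0,1)`, for `ψ` in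
`C_c^∞(0,1)`. -/
theorem exists_even_periodic_primitive {ψ : ℝ → ℝ} (hψ : ContDiff ℝ ∞ ψ)
    (hs : tsupport ψ ⊆ Ioo 0 1) :
    ∃ E : ℝ → ℝ, ContDiff ℝ ∞ E ∧ Function.Periodic E 2 ∧ (∀ x, E (-x) = E x) ∧
      ∀ x ∈ Ioo (0 : ℝ) 1, deriv E x = ψ x := by
  set P : ℝ → ℝ := fun x => ∫ r in (0 : ℝ)..x, ψ r with hP
  have hPd : ∀ x, HasDerivAt P (ψ x) x := fun x =>
    intervalIntegral.integral_hasDerivAt_right (hψ.continuous.intervalIntegrable _ _)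
      (hψ.continuous.stronglyMeasurableAtFilter _ _) hψ.continuous.continuousAt
  have hPc : ContDiff ℝ ∞ P := by
    rw [contDiff_infty_iff_deriv]
    exact ⟨fun x => (hPd x).differentiableAt, by rwa [funext fun x => (hPd x).deriv]⟩
  -- The primitive is locally constant off the support of `ψ`, in particular near `0` and near `1`.
  have hloc : ∀ a, a ∉ tsupport ψ → ∀ᶠ x in 𝓝 a, P x = P a := by
    intro a ha
    obtain ⟨ε, hε, hball⟩ := Metric.isOpen_iff.1 (isClosed_tsupport ψ).isOpen_compl a ha
    filter_upwards [Metric.ball_mem_nhds a hε] with x hx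
    refine (convex_ball a ε).is_const_of_fderivWithin_eq_zero (𝕜 := ℝ)
      (fun z _ => (hPd z).differentiableAt.differentiableWithinAt) ?_ hx (Metric.mem_ball_self hε)
    intro z hz
    have hz0 : ψ z = 0 := image_eq_zero_of_notMem_tsupport (hball hz)
    rw [fderivWithin_of_isOpen Metric.isOpen_ball hz]
    have := (hPd z).hasFDerivAt.fderiv
    rw [this, hz0]
    ext; simp
  have hpi := Real.pi_pos
  -- Writing the extension as `G (cos (π x))` makes it even and `2`-periodic at once. On `(0,1)` it
  -- equals `P x`, because `arccos` inverts the cosine there.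
  set G : ℝ → ℝ := fun c => P (Real.arccos c / Real.pi) with hG
  have hGc : ContDiff ℝ ∞ G := by
    rw [contDiff_iff_contDiffAt]
    intro c
    have hcont : ContinuousAt (fun c => Real.arccos c / Real.pi) c :=
      (Real.continuous_arccos.div_const _).continuousAt
    have hconst : Real.arccos c / Real.pi ∉ tsupport ψ → ContDiffAt ℝ ∞ G c := by
      intro hn
      exact (contDiffAt_const (c := G c)).congr_of_eventuallyEq (hcont.eventually (hloc _ hn))
    by_cases hc : -1 < c ∧ c < 1
    · exact hPc.contDiffAt.comp c
        ((Real.contDiffAt_arccos hc.1.ne' hc.2.ne).div_const _)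
    -- For `|c| ≥ 1`, where `arccos` fails to be smooth or is constant, `arccos c / π` is `0` or
    -- `1`, outside the support of `ψ`; local constancy of `P` then gives smoothness of `G`.
    · refine hconst fun hn => ?_
      have hm := hs hn
      rcases not_and_or.1 hc with h | h
      · rw [Real.arccos_of_le_neg_one (not_lt.1 h), div_self hpi.ne'] at hm
        exact lt_irrefl _ hm.2
      · rw [Real.arccos_of_one_le (not_lt.1 h), zero_div] at hm
        exact lt_irrefl _ hm.1
  refine ⟨fun x => G (Real.cos (Real.pi * x)),
    hGc.comp (Real.contDiff_cos.comp (by fun_prop)), ?_, ?_, ?_⟩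
  · intro x
    simp only
    rw [show Real.pi * (x + 2) = Real.pi * x + 2 * Real.pi by ring, Real.cos_add_two_pi]
  · intro x
    simp only
    rw [mul_neg, Real.cos_neg]
  · intro x hx
    have : (fun x => G (Real.cos (Real.pi * x))) =ᶠ[𝓝 x] P := by
      filter_upwards [Ioo_mem_nhds hx.1 hx.2] with z hz
      simp only [hG]
      rw [Real.arccos_cos (by nlinarith [hz.1]) (by nlinarith [hz.2]),
        mul_div_cancel_left₀ _ hpi.ne']
    rw [this.deriv_eq, (hPd x).deriv]

/-- The time-independent test function given by `ψ ∈ C^∞` with `ψ(0) = ψ(1) = 0`. -/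
def TestFunction.static (ψ : ℝ → ℝ) (hψ : ContDiff ℝ ∞ ψ) (h0 : ψ 0 = 0) (h1 : ψ 1 = 0) :
    TestFunction where
  toFun _ x := ψ x
  smooth := hψ.comp contDiff_snd
  left _ := h0
  right _ := h1

/-- Two functionals on `H¹₀(0,1)` that agree on `C_c^∞(0,1)` are equal. -/
theorem HNegOne.ext_smooth {v w : HNegOne}
    (h : ∀ (ψ : ℝ → ℝ) (hψ : ContDiff ℝ ∞ ψ) (h0 : ψ 0 = 0) (h1 : ψ 1 = 0),
      v (toH10 ψ hψ h0 h1) = w (toH10 ψ hψ h0 h1)) : v = w := by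
  set S : Submodule ℝ H10 := LinearMap.ker ((v - w : HNegOne) : H10 →ₗ[ℝ] ℝ) with hS
  have hSc : IsClosed (S : Set H10) := (v - w).isClosed_ker
  -- The kernel of `v - w`, seen inside `L2L2`, contains the test pairs. It is closed there because
  -- `H10` is, hence it contains their closed span `H10`.
  have hspan : Submodule.span ℝ testPairs ≤ S.map H10.subtype := by
    refine Submodule.span_le.2 ?_
    rintro p ⟨ψ, hψ, -, hs, hf, hg⟩
    have h0 : ψ 0 = 0 := image_eq_zero_of_notMem_tsupport fun h' => lt_irrefl _ (hs h').1
    have h1 : ψ 1 = 0 := image_eq_zero_of_notMem_tsupport fun h' => lt_irrefl _ (hs h').2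
    refine ⟨toH10 ψ hψ h0 h1, ?_, ?_⟩
    · change (v - w) (toH10 ψ hψ h0 h1) = 0
      rw [sub_apply, h, sub_self]
    · refine (WithLp.ofLp_injective 2) (Prod.ext ?_ ?_)
      · exact Lp.ext ((toH10_fst_ae hψ h0 h1).trans hf.symm)
      · exact Lp.ext ((toH10_snd_ae hψ h0 h1).trans hg.symm)
  have hcl : IsClosed ((S.map H10.subtype : Submodule ℝ L2L2) : Set L2L2) := by
    have hH : IsClosed (H10 : Set L2L2) := Submodule.isClosed_topologicalClosure _
    exact hH.isClosedEmbedding_subtypeVal.isClosedMap _ hSc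
  have htop : H10 ≤ S.map H10.subtype := Submodule.topologicalClosure_minimal _ hspan hcl
  ext p
  obtain ⟨q, hq, hqp⟩ := htop p.2
  have : q = p := Subtype.ext hqp
  subst this
  have : (v - w) q = 0 := hq
  rwa [sub_apply, sub_eq_zero] at this

theorem integrable_mul_continuous (y : L2) {g : ℝ → ℝ} (hg : Continuous g) :
    Integrable (fun x => y x * g x) unitMeasure :=
  MemLp.integrable_mul (Lp.memLp y) (memLp_of_continuous hg)

theorem L2.ext_of_integral_smooth {y z : L2}
    (h : ∀ ψ : ℝ → ℝ, ContDiff ℝ ∞ ψ → HasCompactSupport ψ → tsupport ψ ⊆ Ioo 0 1 →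
      ∫ x, y x * ψ x ∂unitMeasure = ∫ x, z x * ψ x ∂unitMeasure) : y = z := by
  have hint : ∀ w : L2, IntegrableOn w (Ioo 0 1) volume := fun w =>
    (Lp.memLp w).integrable one_le_two
  have hz := isOpen_Ioo.ae_eq_zero_of_integral_contDiff_smul_eq_zero (U := Ioo (0 : ℝ) 1)
    (μ := volume) (f := fun x => y x - z x) ((hint y).sub (hint z)).locallyIntegrableOn ?_
  · refine Lp.ext ?_
    filter_upwards [(ae_restrict_iff' measurableSet_Ioo).2 hz] with x hx
    linarith
  · intro ψ hψ hc hs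
    have e : ∫ x, ψ x • (y x - z x) = ∫ x, (y x * ψ x - z x * ψ x) ∂unitMeasure := by
      rw [← setIntegral_eq_integral_of_forall_compl_eq_zero (s := Ioo (0 : ℝ) 1)]
      · refine integral_congr_ae (Eventually.of_forall fun x => ?_)
        simp only [smul_eq_mul]; ring
      · intro x hx
        rw [image_eq_zero_of_notMem_tsupport fun h' => hx (hs h'), zero_smul]
    rw [e, integral_sub (integrable_mul_continuous y hψ.continuous)
      (integrable_mul_continuous z hψ.continuous), h ψ hψ hc hs, sub_self]

/-- Duality: a test function that solves the homogeneous wave equation with data `φ(s) = 0`, `φ_t(s)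
= ψ` expresses `∫ y(s) ψ` through the initial data and the controls alone. -/
theorem IsSolution.eqOn_state {T : ℝ} {a : L2} {b : HNegOne} {u₀ u₁ : ℝ → ℝ}
    {y y' : ℝ → L2} {v v' : ℝ → HNegOne} (h : IsSolution T a b u₀ u₁ y v)
    (h' : IsSolution T a b u₀ u₁ y' v') : EqOn y y' (Icc 0 T) := by
  intro s hs
  refine L2.ext_of_integral_smooth fun ψ hψ _ hsupp => ?_
  obtain ⟨E, hE, hper, heven, hderiv⟩ := exists_even_periodic_primitive hψ hsupp
  -- At `t = s` the test function is `(E(x) - E(-x)) / 2 = 0` since `E` is even. Its time derivative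
  -- is `(E'(x) - E'(-x)) / 2 = E'(x)` since `E'` is odd.
  have hA : ContDiff ℝ ∞ (fun z => E (z - s) / 2) := (hE.comp (by fun_prop)).div_const _
  have hp : Function.Periodic (fun z => E (z - s) / 2) 2 := fun z => by
    simp only
    rw [show z + 2 - s = z - s + 2 by ring, hper]
  set φ := TestFunction.ofPeriodic _ hA hp with hφ
  have hslice : φ.slice s = 0 := by
    have hz : φ.toFun s = fun _ => 0 := by
      funext x
      simp [hφ, TestFunction.ofPeriodic, heven]
    refine Subtype.ext ((WithLp.ofLp_injective 2) (Prod.ext ?_ ?_))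
    · refine Lp.ext ((toH10_fst_ae _ _ _).trans (EventuallyEq.trans ?_ (Lp.coeFn_zero ..).symm))
      exact Eventually.of_forall fun x => by rw [hz]; rfl
    · refine Lp.ext ((toH10_snd_ae _ _ _).trans (EventuallyEq.trans ?_ (Lp.coeFn_zero ..).symm))
      exact Eventually.of_forall fun x => by rw [hz]; simp
  have hodd : ∀ x, deriv E (-x) = -deriv E x := fun x => by
    have := deriv_comp_neg (f := E) (x := x)
    rw [funext heven] at this
    linarith
  have hdt : ∀ x ∈ Ioo (0 : ℝ) 1, φ.dt s x = ψ x := by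
    intro x hx
    have hdA : ∀ z, deriv (fun z => E (z - s) / 2) z = deriv E (z - s) / 2 := fun z => by
      rw [deriv_div_const, deriv_comp_sub_const (f := E)]
    rw [hφ, TestFunction.ofPeriodic_dt, hdA, hdA, add_sub_cancel_left,
      show s - x - s = -x by ring, hodd, hderiv x hx]
    ring
  have hint : ∀ w : L2, ∫ x, w x * φ.dt s x ∂unitMeasure = ∫ x, w x * ψ x ∂unitMeasure :=
    fun w => setIntegral_congr_fun measurableSet_Ioo fun x hx => by simp only [hdt x hx]
  have k := h.transposition φ s hs
  have k' := h'.transposition φ s hs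
  have hbox : ∀ t x, φ.box t x = 0 := TestFunction.ofPeriodic_box hA hp
  simp only [hbox, hslice, hint, h.initial_state, h.initial_velocity] at k
  simp only [hbox, hslice, hint, h'.initial_state, h'.initial_velocity] at k'
  simp only [mul_zero, integral_zero, map_zero] at k k'
  linarith

/-- With a time-independent test function, every term except `v s ψ` involves only the states, the
data and the controls, which already agree. -/
theorem IsSolution.eqOn_velocity {T : ℝ} {a : L2} {b : HNegOne} {u₀ u₁ : ℝ → ℝ}
    {y y' : ℝ → L2} {v v' : ℝ → HNegOne} (h : IsSolution T a b u₀ u₁ y v)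
    (h' : IsSolution T a b u₀ u₁ y' v') : EqOn v v' (Icc 0 T) := by
  intro s hs
  refine HNegOne.ext_smooth fun ψ hψ h0 h1 => ?_
  have hy := h.eqOn_state h'
  set φ := TestFunction.static ψ hψ h0 h1 with hφ
  have k := h.transposition φ s hs
  have k' := h'.transposition φ s hs
  have e : ∫ t in (0 : ℝ)..s, ∫ x, y t x * φ.box t x ∂unitMeasure =
      ∫ t in (0 : ℝ)..s, ∫ x, y' t x * φ.box t x ∂unitMeasure := by
    refine intervalIntegral.integral_congr fun t ht => ?_
    rw [uIcc_of_le hs.1] at ht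
    simp only [hy ⟨ht.1, ht.2.trans hs.2⟩]
  rw [e, k', hy hs, h.initial_state, h'.initial_state, h.initial_velocity,
    h'.initial_velocity] at k
  change v s (φ.slice s) = v' s (φ.slice s)
  linarith

theorem IsSolution.isUniqueSolution {T : ℝ} {a : L2} {b : HNegOne} {u₀ u₁ : ℝ → ℝ}
    {y : ℝ → L2} {v : ℝ → HNegOne} (h : IsSolution T a b u₀ u₁ y v) :
    IsUniqueSolution T a b u₀ u₁ y v :=
  ⟨h, fun _ _ h' => ⟨h'.eqOn_state h, h'.eqOn_velocity h⟩⟩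

/-! ### Travelling waves -/

/-- The transposition formula on `[0,s]` for the travelling wave `p(t + x)`, after an integration
by parts in the velocity term. -/
def TransportIdentity (φ : TestFunction) (s : ℝ) (p : ℝ → ℝ) : Prop :=
  (∫ t in (0 : ℝ)..s, ∫ x, p (t + x) * φ.box t x ∂unitMeasure) =
    (∫ x, p (s + x) * (φ.dt s x + φ.dx s x) ∂unitMeasure)
      - (∫ x, p (0 + x) * (φ.dt 0 x + φ.dx 0 x) ∂unitMeasure)
      - ∫ t in (0 : ℝ)..s, (p (t + 1) * φ.dx t 1 - p t * φ.dx t 0)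

/-- Divergence theorem for the field `(f, -f)` with `f = p(t + x) (φ_t + φ_x)`. The operator `∂_t -
∂_x` annihilates `p(t + x)` and sends `φ_t + φ_x` to `φ_tt - φ_xx`, the mixed derivatives
cancelling. -/
theorem transportIdentity_of_contDiff (φ : TestFunction) (s : ℝ) {p : ℝ → ℝ}
    (hp : ContDiff ℝ ∞ p) : TransportIdentity φ s p := by
  set F : ℝ × ℝ → ℝ := fun z => φ.dt z.1 z.2 + φ.dx z.1 z.2 with hF
  set f : ℝ × ℝ → ℝ := fun z => p (z.1 + z.2) * F z with hf
  have hFc : ContDiff ℝ ∞ F := φ.contDiff_dt.add φ.contDiff_dx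
  have hfc : ContDiff ℝ ∞ f := (hp.comp (by fun_prop)).mul hFc
  have hd : ∀ z, DifferentiableAt ℝ f z := hfc.differentiable (by simp)
  have hdp : Differentiable ℝ p := hp.differentiable (by simp)
  have hdF : ∀ z, DifferentiableAt ℝ F z := hFc.differentiable (by simp)
  have hFfd : ∀ z e, fderiv ℝ F z e = fderiv ℝ (fun p : ℝ × ℝ => φ.dt p.1 p.2) z e
      + fderiv ℝ (fun p : ℝ × ℝ => φ.dx p.1 p.2) z e := fun z e => by
    rw [hF, fderiv_fun_add (φ.contDiff_dt.differentiable (by simp) z)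
      (φ.contDiff_dx.differentiable (by simp) z)]
    rfl
  have hbox : ∀ t x, fderiv ℝ f (t, x) (1, 0) + (-fderiv ℝ f (t, x)) (0, 1) =
      p (t + x) * φ.box t x := by
    intro t x
    have e1 : fderiv ℝ f (t, x) (1, 0) = _ := (hasDerivAt_fst (hd (t, x))).unique
      (((hdp _).hasDerivAt.comp_add_const t x).fun_mul (hasDerivAt_fst (hdF (t, x))))
    have e2 : fderiv ℝ f (t, x) (0, 1) = _ := (hasDerivAt_snd (hd (t, x))).unique
      (((hdp _).hasDerivAt.comp_const_add t x).fun_mul (hasDerivAt_snd (hdF (t, x))))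
    rw [neg_apply, e1, e2, hFfd, hFfd, φ.box_eq_fderiv, φ.fderiv_dt_snd]
    ring
  have hboxc : Continuous fun z : ℝ × ℝ => p (z.1 + z.2) * φ.box z.1 z.2 :=
    (hp.continuous.comp (by fun_prop)).mul φ.continuous_box
  have key := integral2_divergence_prod_of_hasFDerivAt f (fun z => -f z) (fderiv ℝ f)
    (fun z => -fderiv ℝ f z) 0 0 s 1 hfc.continuous.continuousOn hfc.continuous.neg.continuousOn
    (fun z _ => (hd z).hasFDerivAt) (fun z _ => (hd z).hasFDerivAt.neg) (by
      refine ContinuousOn.integrableOn_compact (isCompact_uIcc.prod isCompact_uIcc) ?_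
      exact (hboxc.congr fun z => (hbox z.1 z.2).symm).continuousOn)
  simp only [hbox] at key
  have hi : ∀ x, IntervalIntegrable (fun t => f (t, x)) volume 0 s := fun x =>
    (hfc.continuous.comp (by fun_prop : Continuous fun t : ℝ => (t, x))).intervalIntegrable _ _
  -- On the lateral sides `φ_t = 0`, so `f` reduces to the trace of `p` times `φ_x`.
  have hb : ∫ t in (0 : ℝ)..s, (p (t + 1) * φ.dx t 1 - p t * φ.dx t 0) =
      (∫ t in (0 : ℝ)..s, f (t, 1)) - ∫ t in (0 : ℝ)..s, f (t, 0) := by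
    rw [← intervalIntegral.integral_sub (hi 1) (hi 0)]
    refine intervalIntegral.integral_congr fun t _ => ?_
    simp [hf, hF, φ.dt_left, φ.dt_right]
  unfold TransportIdentity
  rw [hb]
  simp only [integral_unitMeasure]
  rw [key]
  simp only [intervalIntegral.integral_neg]
  simp only [hf, hF]
  ring

/-! ### Bounded limits of the transport identity. -/

theorem exists_bound_on_strip {K : ℝ × ℝ → ℝ} (hK : Continuous K) (s : ℝ) :
    ∃ B, 0 ≤ B ∧ ∀ t ∈ Icc 0 s, ∀ x ∈ Icc (0 : ℝ) 1, |K (t, x)| ≤ B := by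
  obtain ⟨B, hB⟩ := (isCompact_Icc.prod isCompact_Icc).exists_bound_of_continuousOn
    (s := Icc 0 s ×ˢ Icc (0 : ℝ) 1) hK.continuousOn
  exact ⟨max B 0, le_max_right _ _, fun t ht x hx => (hB (t, x) ⟨ht, hx⟩).trans (le_max_left _ _)⟩

theorem intervalIntegrable_of_bound {f : ℝ → ℝ} (hf : Measurable f) {s C : ℝ} (hs : 0 ≤ s)
    (hC : ∀ x ∈ Ioc 0 s, |f x| ≤ C) : IntervalIntegrable f volume 0 s := by
  rw [intervalIntegrable_iff, uIoc_of_le hs]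
  refine Integrable.of_bound hf.aestronglyMeasurable C ?_
  filter_upwards [ae_restrict_mem measurableSet_Ioc] with x hx using hC x hx

theorem abs_integral_unitMeasure_le {f : ℝ → ℝ} {C : ℝ}
    (hC : ∀ x ∈ Ioo (0 : ℝ) 1, |f x| ≤ C) : |∫ x, f x ∂unitMeasure| ≤ C := by
  have := norm_setIntegral_le_of_norm_le_const (μ := volume) (s := Ioo (0 : ℝ) 1) (f := f) (C := C)
    (by simp) hC
  simpa using this

theorem measurable_integral_unitMeasure {f : ℝ × ℝ → ℝ} (hf : Measurable f) :
    Measurable fun t => ∫ x, f (t, x) ∂unitMeasure :=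
  (hf.stronglyMeasurable.integral_prod_right' (ν := unitMeasure)).measurable

theorem tendsto_integral_unitMeasure {f : ℕ → ℝ → ℝ} {g : ℝ → ℝ} (hf : ∀ n, Measurable (f n))
    {C : ℝ} (hC : ∀ n, ∀ x ∈ Ioo (0 : ℝ) 1, |f n x| ≤ C)
    (h : ∀ x ∈ Ioo (0 : ℝ) 1, Tendsto (fun n => f n x) atTop (𝓝 (g x))) :
    Tendsto (fun n => ∫ x, f n x ∂unitMeasure) atTop (𝓝 (∫ x, g x ∂unitMeasure)) := by
  refine tendsto_integral_of_dominated_convergence (fun _ => C)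
    (fun n => (hf n).aestronglyMeasurable) (integrable_const C) (fun n => ?_) ?_
  · filter_upwards [ae_restrict_mem measurableSet_Ioo] with x hx using hC n x hx
  · filter_upwards [ae_restrict_mem measurableSet_Ioo] with x hx using h x hx

theorem tendsto_intervalIntegral_of_bound {f : ℕ → ℝ → ℝ} {g : ℝ → ℝ} {s C : ℝ} (hs : 0 ≤ s)
    (hf : ∀ n, Measurable (f n)) (hC : ∀ n, ∀ x ∈ Ioc 0 s, |f n x| ≤ C)
    (h : ∀ x ∈ Ioc 0 s, Tendsto (fun n => f n x) atTop (𝓝 (g x))) :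
    Tendsto (fun n => ∫ x in (0 : ℝ)..s, f n x) atTop (𝓝 (∫ x in (0 : ℝ)..s, g x)) := by
  refine intervalIntegral.tendsto_integral_filter_of_dominated_convergence (fun _ => C)
    (Eventually.of_forall fun n => (hf n).aestronglyMeasurable)
    (Eventually.of_forall fun n => Eventually.of_forall fun x hx => ?_)
    intervalIntegrable_const (Eventually.of_forall fun x hx => ?_)
  · rw [uIoc_of_le hs] at hx; exact hC n x hx
  · rw [uIoc_of_le hs] at hx; exact h x hx

theorem abs_mul_le_of_le {a b C B : ℝ} (ha : |a| ≤ C) (hb : |b| ≤ B) : |a * b| ≤ C * B := by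
  rw [abs_mul]
  exact mul_le_mul ha hb (abs_nonneg _) ((abs_nonneg _).trans ha)

/-- The transport identity is stable under bounded pointwise limits. -/
theorem TransportIdentity.of_tendsto {φ : TestFunction} {s C : ℝ} (hs : 0 ≤ s) {p : ℕ → ℝ → ℝ}
    {q : ℝ → ℝ} (hm : ∀ n, Measurable (p n)) (hC : ∀ n, ∀ z ∈ Icc 0 (s + 1), |p n z| ≤ C)
    (hlim : ∀ z ∈ Icc 0 (s + 1), Tendsto (fun n => p n z) atTop (𝓝 (q z)))
    (h : ∀ n, TransportIdentity φ s (p n)) : TransportIdentity φ s q := by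
  -- Only the values of the profile on `[0, s + 1]` enter, which is why bounds and convergence are
  -- needed there only. Dominated convergence is then applied term by term.
  have hmem : ∀ t ∈ Icc 0 s, ∀ x ∈ Icc (0 : ℝ) 1, t + x ∈ Icc 0 (s + 1) := fun t ht x hx =>
    ⟨add_nonneg ht.1 hx.1, add_le_add ht.2 hx.2⟩
  have hslice : ∀ {K : ℝ × ℝ → ℝ}, Continuous K → ∀ t ∈ Icc 0 s,
      Tendsto (fun n => ∫ x, p n (t + x) * K (t, x) ∂unitMeasure) atTop
        (𝓝 (∫ x, q (t + x) * K (t, x) ∂unitMeasure)) := by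
    intro K hK t ht
    obtain ⟨B, hB0, hB⟩ := exists_bound_on_strip hK s
    refine tendsto_integral_unitMeasure (C := C * B) (fun n => ?_) (fun n x hx => ?_)
      (fun x hx => ?_)
    · exact ((hm n).comp (by fun_prop)).mul (hK.comp (by fun_prop)).measurable
    · exact abs_mul_le_of_le (hC n _ (hmem t ht x ⟨hx.1.le, hx.2.le⟩))
        (hB t ht x ⟨hx.1.le, hx.2.le⟩)
    · exact (hlim _ (hmem t ht x ⟨hx.1.le, hx.2.le⟩)).mul_const _
  have hFc : Continuous fun z : ℝ × ℝ => φ.dt z.1 z.2 + φ.dx z.1 z.2 :=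
    φ.contDiff_dt.continuous.add φ.contDiff_dx.continuous
  have l2 := hslice hFc s ⟨hs, le_rfl⟩
  have l3 := hslice hFc 0 ⟨le_rfl, hs⟩
  have l1 : Tendsto (fun n => ∫ t in (0 : ℝ)..s, ∫ x, p n (t + x) * φ.box t x ∂unitMeasure) atTop
      (𝓝 (∫ t in (0 : ℝ)..s, ∫ x, q (t + x) * φ.box t x ∂unitMeasure)) := by
    obtain ⟨B, hB0, hB⟩ := exists_bound_on_strip φ.continuous_box s
    refine tendsto_intervalIntegral_of_bound (C := C * B) hs (fun n => ?_) (fun n t ht => ?_)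
      (fun t ht => hslice φ.continuous_box t ⟨ht.1.le, ht.2⟩)
    · exact measurable_integral_unitMeasure
        (f := fun z : ℝ × ℝ => p n (z.1 + z.2) * φ.box z.1 z.2)
        (((hm n).comp (by fun_prop)).mul φ.continuous_box.measurable)
    · refine abs_integral_unitMeasure_le fun x hx => ?_
      exact abs_mul_le_of_le (hC n _ (hmem t ⟨ht.1.le, ht.2⟩ x ⟨hx.1.le, hx.2.le⟩))
        (hB t ⟨ht.1.le, ht.2⟩ x ⟨hx.1.le, hx.2.le⟩)
  have l4 : Tendsto (fun n => ∫ t in (0 : ℝ)..s, (p n (t + 1) * φ.dx t 1 - p n t * φ.dx t 0))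
      atTop (𝓝 (∫ t in (0 : ℝ)..s, (q (t + 1) * φ.dx t 1 - q t * φ.dx t 0))) := by
    have hdx := φ.contDiff_dx.continuous
    have hdx' : ∀ x, Measurable fun t => φ.dx t x := fun x =>
      (hdx.comp (by fun_prop : Continuous fun t : ℝ => (t, x))).measurable
    obtain ⟨B, hB0, hB⟩ := exists_bound_on_strip hdx s
    refine tendsto_intervalIntegral_of_bound (C := C * B + C * B) hs (fun n => ?_)
      (fun n t ht => ?_) (fun t ht => ?_)
    · exact (((hm n).comp (by fun_prop)).mul (hdx' 1)).sub ((hm n).mul (hdx' 0))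
    · have ht' : t ∈ Icc 0 s := ⟨ht.1.le, ht.2⟩
      have h1 := hmem t ht' 1 (by simp)
      have h0 := hmem t ht' 0 (by simp)
      rw [add_zero] at h0
      exact (abs_sub _ _).trans (add_le_add (abs_mul_le_of_le (hC n _ h1) (hB t ht' 1 (by simp)))
        (abs_mul_le_of_le (hC n _ h0) (hB t ht' 0 (by simp))))
    · have ht' : t ∈ Icc 0 s := ⟨ht.1.le, ht.2⟩
      have h1 := hmem t ht' 1 (by simp)
      have h0 := hmem t ht' 0 (by simp)
      rw [add_zero] at h0
      exact ((hlim _ h1).mul_const _).sub ((hlim _ h0).mul_const _)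
  refine tendsto_nhds_unique l1 (((l2.sub l3).sub l4).congr fun n => ?_)
  exact (h n).symm

/-- Weierstrass approximation on `[0, s + 1]` by polynomials, which are smooth. An error of at most
`1` gives the common bound `C + 1`. -/
theorem transportIdentity_of_continuous (φ : TestFunction) {s : ℝ} (hs : 0 ≤ s) {p : ℝ → ℝ}
    (hp : Continuous p) : TransportIdentity φ s p := by
  have hex : ∀ n : ℕ, ∃ P : Polynomial ℝ, ∀ x ∈ Icc 0 (s + 1),
      |P.eval x - p x| < 1 / ((n : ℝ) + 1) := fun n =>
    exists_polynomial_near_of_continuousOn 0 (s + 1) p hp.continuousOn _ (by positivity)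
  choose P hP using hex
  obtain ⟨C, hC⟩ := isCompact_Icc.exists_bound_of_continuousOn
    (s := Icc 0 (s + 1)) hp.continuousOn
  refine TransportIdentity.of_tendsto (p := fun n z => (P n).eval z) (C := C + 1) hs
    (fun n => (P n).continuous.measurable) (fun n z hz => ?_) (fun z hz => ?_)
    (fun n => transportIdentity_of_contDiff φ s (by simpa using (P n).contDiff_aeval (𝕜 := ℝ) ∞))
  · have h1 := hP n z hz
    have h2 : 1 / ((n : ℝ) + 1) ≤ 1 := by
      rw [div_le_one (by positivity)]
      linarith [Nat.cast_nonneg (α := ℝ) n]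
    have h3 : |p z| ≤ C := hC z hz
    have h4 := abs_add_le ((P n).eval z - p z) (p z)
    rw [sub_add_cancel] at h4
    linarith
  · rw [tendsto_iff_dist_tendsto_zero]
    exact squeeze_zero (fun n => dist_nonneg) (fun n => (hP n z hz).le)
      tendsto_one_div_add_atTop_nhds_zero_nat

/-- The step function equal to `a` on `(-∞,1]` and to `b` on `(1,∞)`. -/
def step (a b z : ℝ) : ℝ := if z ≤ 1 then a else b

/-- The transitions `smoothTransition (n (z - 1))` steepen to a jump. They vanish for `z ≤ 1`, so
the limit is pointwise everywhere and takes the left value `a` at the jump, as `step` prescribes. -/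
theorem transportIdentity_step (φ : TestFunction) {s : ℝ} (hs : 0 ≤ s) (a b : ℝ) :
    TransportIdentity φ s (step a b) := by
  have hS : Continuous Real.smoothTransition := Real.smoothTransition.continuous
  have hc : ∀ n : ℕ, Continuous fun z : ℝ => a + (b - a) * Real.smoothTransition (n * (z - 1)) :=
    fun n => by fun_prop
  refine TransportIdentity.of_tendsto (C := |a| + |b - a|) hs (fun n => (hc n).measurable)
    (fun n z _ => ?_) (fun z _ => ?_) (fun n => transportIdentity_of_continuous φ hs (hc n))
  · refine (abs_add_le _ _).trans (add_le_add_right ?_ _)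
    rw [abs_mul, abs_of_nonneg (Real.smoothTransition.nonneg _)]
    exact mul_le_of_le_one_right (abs_nonneg _) (Real.smoothTransition.le_one _)
  · unfold step
    split_ifs with hz
    · refine tendsto_const_nhds.congr fun n => ?_
      rw [Real.smoothTransition.zero_of_nonpos
        (mul_nonpos_of_nonneg_of_nonpos (Nat.cast_nonneg n) (by linarith))]
      simp
    · have hz' : 0 < z - 1 := by linarith
      obtain ⟨N, hN⟩ := exists_nat_gt (1 / (z - 1))
      refine tendsto_const_nhds.congr' ?_
      filter_upwards [eventually_ge_atTop N] with n hn
      have hn' : (N : ℝ) ≤ n := by exact_mod_cast hn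
      rw [Real.smoothTransition.one_of_one_le]
      · ring
      · rw [div_lt_iff₀ hz'] at hN
        nlinarith

theorem integral_unitMeasure_reflect (f : ℝ → ℝ) :
    ∫ x, f (1 - x) ∂unitMeasure = ∫ x, f x ∂unitMeasure := by
  rw [integral_unitMeasure, integral_unitMeasure, intervalIntegral.integral_comp_sub_left f 1]
  simp

/-- The transport identity for the wave `p(t + 1 - x)` travelling to the right. -/
theorem TransportIdentity.reflect {φ : TestFunction} {s : ℝ} {p : ℝ → ℝ}
    (h : TransportIdentity φ.reflect s p) :
    (∫ t in (0 : ℝ)..s, ∫ x, p (t + (1 - x)) * φ.box t x ∂unitMeasure) =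
      (∫ x, p (s + (1 - x)) * (φ.dt s x - φ.dx s x) ∂unitMeasure)
        - (∫ x, p (0 + (1 - x)) * (φ.dt 0 x - φ.dx 0 x) ∂unitMeasure)
        - ∫ t in (0 : ℝ)..s, (p t * φ.dx t 1 - p (t + 1) * φ.dx t 0) := by
  unfold TransportIdentity at h
  simp only [TestFunction.reflect_box, TestFunction.reflect_dt, TestFunction.reflect_dx] at h
  -- The substitution `x ↦ 1 - x` moves the reflection from the test function to the profile.
  have e : ∀ t : ℝ, ∀ g : ℝ → ℝ, ∫ x, p (t + x) * g (1 - x) ∂unitMeasure =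
      ∫ x, p (t + (1 - x)) * g x ∂unitMeasure := fun t g => by
    rw [← integral_unitMeasure_reflect]
    simp only [sub_sub_cancel]
  rw [e s (fun x => φ.dt s x + -φ.dx s x), e 0 (fun x => φ.dt 0 x + -φ.dx 0 x)] at h
  simp only [fun t => e t (φ.box t)] at h
  simp only [sub_eq_add_neg] at h ⊢
  rw [h]
  congr 2
  refine intervalIntegral.integral_congr fun t _ => ?_
  simp only [add_neg_cancel, neg_zero, add_zero]
  ring

/-- The functional `-⟨z, ψ'⟩` on `H¹₀(0,1)`: the distributional derivative of `z ∈ L²(0,1)`. -/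
def weakDeriv (z : L2) : HNegOne :=
  -((innerSL ℝ z).comp ((ContinuousLinearMap.snd ℝ L2 L2).comp
    ((WithLp.prodContinuousLinearEquiv 2 ℝ L2 L2).toContinuousLinearMap.comp H10.subtypeL)))

/-- Reduces continuity of the velocity in `H⁻¹` to continuity of a curve in `L²`. -/
theorem continuous_weakDeriv : Continuous weakDeriv := by
  unfold weakDeriv
  exact ((innerSL ℝ (E := L2)).continuous.clm_comp continuous_const).neg

theorem weakDeriv_toH10 {z : L2} {f ψ : ℝ → ℝ} (hz : z =ᵐ[unitMeasure] f) (hψ : ContDiff ℝ ∞ ψ)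
    (h0 : ψ 0 = 0) (h1 : ψ 1 = 0) :
    weakDeriv z (toH10 ψ hψ h0 h1) = -∫ x, f x * deriv ψ x ∂unitMeasure := by
  change -(inner ℝ z (toH10 ψ hψ h0 h1 : L2L2).snd) = _
  rw [L2.inner_def]
  congr 1
  refine integral_congr_ae ?_
  filter_upwards [hz, toH10_snd_ae hψ h0 h1] with x hx1 hx2
  rw [hx1, hx2]
  simp [mul_comm]

theorem weakDeriv_constState (c : ℝ) : weakDeriv (constState c) = 0 := by
  refine HNegOne.ext_smooth fun ψ hψ h0 h1 => ?_
  rw [weakDeriv_toH10 (constState_ae c) hψ h0 h1, integral_unitMeasure,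
    intervalIntegral.integral_const_mul, intervalIntegral.integral_deriv_eq_sub
      (fun x _ => hψ.differentiable (by simp) x)
      ((hψ.continuous_deriv (by simp)).intervalIntegrable _ _), h0, h1]
  simp

/-! ### Solutions generated by bounded profiles. -/

theorem memLp_unitMeasure_of_bound {f : ℝ → ℝ} (hf : Measurable f) {C : ℝ}
    (hC : ∀ x, |f x| ≤ C) : MemLp f 2 unitMeasure :=
  MemLp.of_bound hf.aestronglyMeasurable C (Eventually.of_forall hC)

theorem integrable_mul_of_bound {f K : ℝ → ℝ} (hf : Measurable f) {C : ℝ} (hC : ∀ x, |f x| ≤ C)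
    (hK : Continuous K) : Integrable (fun x => f x * K x) unitMeasure :=
  MemLp.integrable_mul (memLp_unitMeasure_of_bound hf hC) (memLp_of_continuous hK)

/-- Vitali's theorem along sequences. Continuity in time is required only at almost every `x`, which
leaves room for a moving jump. -/
theorem continuous_toLp {f : ℝ → ℝ → ℝ} (hf : ∀ t, MemLp (f t) 2 unitMeasure) (C : ℝ)
    (hC : ∀ t x, |f t x| ≤ C)
    (h : ∀ t, ∀ᵐ x ∂unitMeasure, ContinuousAt (fun r => f r x) t) :
    Continuous fun t => (hf t).toLp (f t) := by
  rw [continuous_iff_seqContinuous]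
  intro u t hu
  refine (Lp.tendsto_Lp_iff_tendsto_eLpNorm'' (fun n => f (u n)) (fun n => hf (u n)) (f t)
    (hf t)).2 ?_
  refine tendsto_Lp_finite_of_tendsto_ae one_le_two (by simp)
    (fun n => (hf (u n)).aestronglyMeasurable) (hf t) ?_ ?_
  · refine unifIntegrable_of one_le_two (by simp) (fun n => (hf (u n)).aestronglyMeasurable) ?_
    intro ε _
    -- The truncation level exceeds the uniform bound, so the tails are identically zero.
    refine ⟨Real.toNNReal (|C| + 1), fun n => ?_⟩
    rw [eLpNorm_congr_ae (g := fun _ => (0 : ℝ))]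
    · simp
    · refine Eventually.of_forall fun x => Set.indicator_of_notMem (fun hmem => ?_) _
      have h1 : (Real.toNNReal (|C| + 1) : ℝ) ≤ ‖f (u n) x‖ := by exact_mod_cast hmem
      rw [Real.coe_toNNReal _ (by positivity), Real.norm_eq_abs] at h1
      linarith [hC (u n) x, le_abs_self C]
  · filter_upwards [h t] with x hx using hx.tendsto.comp hu

/-- Bounded profiles, continuous away from `1`, whose travelling waves solve the wave equation by
transposition. -/
structure IsProfile (p : ℝ → ℝ) : Prop where
  measurable : Measurable p
  bounded : ∃ C, ∀ z, |p z| ≤ C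
  continuousAt : ∀ z, z ≠ 1 → ContinuousAt p z
  transport : ∀ (φ : TestFunction) (s : ℝ), 0 ≤ s → TransportIdentity φ s p

theorem IsProfile.of_continuous {p : ℝ → ℝ} (hp : Continuous p) (hb : ∃ C, ∀ z, |p z| ≤ C) :
    IsProfile p :=
  ⟨hp.measurable, hb, fun _ _ => hp.continuousAt,
    fun φ _ hs => transportIdentity_of_continuous φ hs hp⟩

theorem isProfile_step (a b : ℝ) : IsProfile (step a b) where
  measurable := Measurable.ite measurableSet_Iic measurable_const measurable_const
  bounded := ⟨max |a| |b|, fun z => by unfold step; split_ifs <;> simp⟩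
  continuousAt z hz := by
    rcases lt_or_gt_of_ne hz with h | h
    · refine (continuousAt_const (y := a)).congr ?_
      filter_upwards [Iio_mem_nhds h] with w hw
      exact (if_pos (le_of_lt hw)).symm
    · refine (continuousAt_const (y := b)).congr ?_
      filter_upwards [Ioi_mem_nhds h] with w hw
      exact (if_neg (not_le.2 hw)).symm
  transport φ _ hs := transportIdentity_step φ hs a b

theorem IsProfile.exists_bound {p q : ℝ → ℝ} (hp : IsProfile p) (hq : IsProfile q)
    : ∃ C, ∀ t x, |p (t + x)| ≤ C ∧ |q (t + (1 - x))| ≤ C := by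
  obtain ⟨C, hC⟩ := hp.bounded
  obtain ⟨D, hD⟩ := hq.bounded
  exact ⟨max C D, fun t x => ⟨(hC _).trans (le_max_left _ _), (hD _).trans (le_max_right _ _)⟩⟩

/-- At time `t` the possible jumps sit at `x = 1 - t` and `x = t` only. -/
theorem IsProfile.ae_continuousAt {p q : ℝ → ℝ} (hp : IsProfile p) (hq : IsProfile q)
    (t : ℝ) : ∀ᵐ x ∂unitMeasure,
    ContinuousAt (fun r => p (r + x)) t ∧ ContinuousAt (fun r => q (r + (1 - x))) t := by
  refine ae_restrict_of_ae ?_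
  filter_upwards [Measure.ae_ne volume (1 - t), Measure.ae_ne volume t] with x h1 h2
  exact ⟨(hp.continuousAt (t + x) fun h => h1 (by linarith)).comp
      (f := fun r : ℝ => r + x) (by fun_prop),
    (hq.continuousAt (t + (1 - x)) fun h => h2 (by linarith)).comp
      (f := fun r : ℝ => r + (1 - x)) (by fun_prop)⟩

theorem IsProfile.memLp_add {p q : ℝ → ℝ} (hp : IsProfile p) (hq : IsProfile q) (t : ℝ) :
    MemLp (fun x => p (t + x) + q (t + (1 - x))) 2 unitMeasure := by
  obtain ⟨C, hC⟩ := hp.exists_bound hq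
  have h1 := hp.measurable
  have h2 := hq.measurable
  exact memLp_unitMeasure_of_bound (by fun_prop)
    fun x => (abs_add_le _ _).trans (add_le_add (hC t x).1 (hC t x).2)

theorem IsProfile.memLp_sub {p q : ℝ → ℝ} (hp : IsProfile p) (hq : IsProfile q) (t : ℝ) :
    MemLp (fun x => p (t + x) - q (t + (1 - x))) 2 unitMeasure := by
  obtain ⟨C, hC⟩ := hp.exists_bound hq
  have h1 := hp.measurable
  have h2 := hq.measurable
  exact memLp_unitMeasure_of_bound (by fun_prop)
    fun x => (abs_sub _ _).trans (add_le_add (hC t x).1 (hC t x).2)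

/-- The state `p(t + x) + q(t + 1 - x)`. -/
def IsProfile.state {p q : ℝ → ℝ} (hp : IsProfile p) (hq : IsProfile q)
    (t : ℝ) : L2 := (hp.memLp_add hq t).toLp

/-- The velocity of `p(t + x) + q(t + 1 - x)`, as the weak derivative of
`p(t + x) - q(t + 1 - x)` in `x`. -/
def IsProfile.velocity {p q : ℝ → ℝ} (hp : IsProfile p) (hq : IsProfile q)
    (t : ℝ) : HNegOne := weakDeriv (hp.memLp_sub hq t).toLp

theorem IsProfile.state_ae {p q : ℝ → ℝ} (hp : IsProfile p) (hq : IsProfile q) (t : ℝ) :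
    hp.state hq t =ᵐ[unitMeasure] fun x => p (t + x) + q (t + (1 - x)) :=
  MemLp.coeFn_toLp _

theorem IsProfile.continuous_state {p q : ℝ → ℝ} (hp : IsProfile p) (hq : IsProfile q)
    : Continuous (hp.state hq) := by
  obtain ⟨C, hC⟩ := hp.exists_bound hq
  refine continuous_toLp (hp.memLp_add hq) (C + C)
    (fun t x => (abs_add_le _ _).trans (add_le_add (hC t x).1 (hC t x).2)) fun t => ?_
  filter_upwards [hp.ae_continuousAt hq t] with x hx using hx.1.add hx.2

theorem IsProfile.continuous_velocity {p q : ℝ → ℝ} (hp : IsProfile p) (hq : IsProfile q)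
    : Continuous (hp.velocity hq) := by
  obtain ⟨C, hC⟩ := hp.exists_bound hq
  refine continuous_weakDeriv.comp (continuous_toLp (hp.memLp_sub hq) (C + C)
    (fun t x => (abs_sub _ _).trans (add_le_add (hC t x).1 (hC t x).2)) fun t => ?_)
  filter_upwards [hp.ae_continuousAt hq t] with x hx using hx.1.sub hx.2

theorem IsProfile.state_eq_const {p q : ℝ → ℝ} (hp : IsProfile p) (hq : IsProfile q)
    {t a b c : ℝ} (ha : ∀ x ∈ Ioo (0 : ℝ) 1, p (t + x) = a)
    (hb : ∀ x ∈ Ioo (0 : ℝ) 1, q (t + x) = b) (hc : a + b = c) :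
    hp.state hq t = constState c := by
  refine Lp.ext ?_
  filter_upwards [hp.state_ae hq t, constState_ae c, ae_restrict_mem measurableSet_Ioo]
    with x h1 h2 hx
  rw [h1, h2, ha x hx, hb (1 - x) ⟨by linarith [hx.2], by linarith [hx.1]⟩, hc]

theorem IsProfile.velocity_eq_zero {p q : ℝ → ℝ} (hp : IsProfile p) (hq : IsProfile q)
    {t a b : ℝ} (ha : ∀ x ∈ Ioo (0 : ℝ) 1, p (t + x) = a)
    (hb : ∀ x ∈ Ioo (0 : ℝ) 1, q (t + x) = b) : hp.velocity hq t = 0 := by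
  rw [← weakDeriv_constState (a - b)]
  refine congrArg weakDeriv (Lp.ext ?_)
  filter_upwards [MemLp.coeFn_toLp (hp.memLp_sub hq t), constState_ae (a - b),
    ae_restrict_mem measurableSet_Ioo] with x h1 h2 hx
  rw [h1, h2, ha x hx, hb (1 - x) ⟨by linarith [hx.2], by linarith [hx.1]⟩]

theorem IsProfile.integral_state {p q : ℝ → ℝ} (hp : IsProfile p) (hq : IsProfile q)
    (t : ℝ) {K : ℝ → ℝ} (hK : Continuous K) :
    ∫ x, hp.state hq t x * K x ∂unitMeasure =
      (∫ x, p (t + x) * K x ∂unitMeasure) + ∫ x, q (t + (1 - x)) * K x ∂unitMeasure := by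
  obtain ⟨C, hC⟩ := hp.exists_bound hq
  have h1 := hp.measurable
  have h2 := hq.measurable
  rw [← integral_add
    (integrable_mul_of_bound (f := fun x => p (t + x)) (by fun_prop) (fun x => (hC t x).1) hK)
    (integrable_mul_of_bound (f := fun x => q (t + (1 - x))) (by fun_prop)
      (fun x => (hC t x).2) hK)]
  refine integral_congr_ae ?_
  filter_upwards [hp.state_ae hq t] with x hx
  rw [hx]
  ring

/-- The velocity is a weak derivative, so `-⟨y_t, φ⟩` becomes the integral of `(p - q) φ_x`.
Collecting `p` and `q` gives exactly the end terms of the two transport identities. -/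
theorem IsProfile.energy_pairing {p q : ℝ → ℝ} (hp : IsProfile p) (hq : IsProfile q)
    (φ : TestFunction) (t : ℝ) :
    (∫ x, hp.state hq t x * φ.dt t x ∂unitMeasure) - hp.velocity hq t (φ.slice t) =
      (∫ x, p (t + x) * (φ.dt t x + φ.dx t x) ∂unitMeasure)
        + ∫ x, q (t + (1 - x)) * (φ.dt t x - φ.dx t x) ∂unitMeasure := by
  obtain ⟨C, hC⟩ := hp.exists_bound hq
  have h1 := hp.measurable
  have h2 := hq.measurable
  have i1 : ∀ {K : ℝ → ℝ}, Continuous K →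
      Integrable (fun x => p (t + x) * K x) unitMeasure := fun hK =>
    integrable_mul_of_bound (by fun_prop) (fun x => (hC t x).1) hK
  have i2 : ∀ {K : ℝ → ℝ}, Continuous K →
      Integrable (fun x => q (t + (1 - x)) * K x) unitMeasure := fun hK =>
    integrable_mul_of_bound (by fun_prop) (fun x => (hC t x).2) hK
  have hdt := φ.continuous_dt t
  have hdx := φ.continuous_dx t
  have hv : hp.velocity hq t (φ.slice t) = -∫ x, (p (t + x) - q (t + (1 - x))) * φ.dx t x
      ∂unitMeasure := weakDeriv_toH10 (MemLp.coeFn_toLp (hp.memLp_sub hq t)) _ _ _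
  rw [hv, hp.integral_state hq t hdt]
  simp only [mul_add, mul_sub, sub_mul]
  rw [integral_add (i1 hdt) (i1 hdx), integral_sub (i2 hdt) (i2 hdx),
    integral_sub (i1 hdx) (i2 hdx)]
  ring

/-- Two travelling waves that are constant at time `0` solve the controlled wave equation with
their boundary values as controls. -/
theorem IsProfile.isSolution {p q : ℝ → ℝ} (hp : IsProfile p) (hq : IsProfile q)
    {T a b c : ℝ} (ha : ∀ x ∈ Ioo (0 : ℝ) 1, p x = a)
    (hb : ∀ x ∈ Ioo (0 : ℝ) 1, q x = b) (hc : a + b = c) {u₀ u₁ : ℝ → ℝ}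
    (hu₀ : ∀ t ∈ Ioo 0 T, u₀ t = p t + q (t + 1))
    (hu₁ : ∀ t ∈ Ioo 0 T, u₁ t = p (t + 1) + q t) :
    IsSolution T (constState c) 0 u₀ u₁ (hp.state hq) (hp.velocity hq) := by
  obtain ⟨C, hC⟩ := hp.bounded
  obtain ⟨D, hD⟩ := hq.bounded
  have h1 := hp.measurable
  have h2 := hq.measurable
  have hmem : ∀ f g : ℝ → ℝ, Measurable g → (∀ t, |g t| ≤ C + D) → (∀ t ∈ Ioo 0 T, f t = g t) →
      MemLp f 2 (volume.restrict (Ioo 0 T)) := fun f g hg hgb hfg => by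
    refine (MemLp.of_bound hg.aestronglyMeasurable (C + D)
      (Eventually.of_forall hgb)).ae_eq ?_
    filter_upwards [ae_restrict_mem measurableSet_Ioo] with t ht using (hfg t ht).symm
  refine ⟨hmem u₀ _ (by fun_prop) (fun t => ?_) hu₀, hmem u₁ _ (by fun_prop) (fun t => ?_) hu₁,
    (hp.continuous_state hq).continuousOn, (hp.continuous_velocity hq).continuousOn,
    hp.state_eq_const hq (by simpa using ha) (by simpa using hb) hc,
    hp.velocity_eq_zero hq (by simpa using ha) (by simpa using hb), ?_⟩
  · exact (abs_add_le _ _).trans (add_le_add (hC _) (hD _))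
  · exact (abs_add_le _ _).trans (add_le_add (hC _) (hD _))
  intro φ s hs
  have hbc := φ.continuous_box
  have hdxm : ∀ x, Measurable fun t => φ.dx t x := fun x =>
    (φ.contDiff_dx.continuous.comp (by fun_prop : Continuous fun t : ℝ => (t, x))).measurable
  obtain ⟨B, hB0, hB⟩ := exists_bound_on_strip hbc s
  obtain ⟨B', hB'0, hB'⟩ := exists_bound_on_strip φ.contDiff_dx.continuous s
  have hlhs : ∫ t in (0 : ℝ)..s, ∫ x, hp.state hq t x * φ.box t x ∂unitMeasure =
      (∫ t in (0 : ℝ)..s, ∫ x, p (t + x) * φ.box t x ∂unitMeasure)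
        + ∫ t in (0 : ℝ)..s, ∫ x, q (t + (1 - x)) * φ.box t x ∂unitMeasure := by
    rw [← intervalIntegral.integral_add]
    · exact intervalIntegral.integral_congr fun t _ =>
        hp.integral_state hq t (hbc.comp (by fun_prop : Continuous fun x : ℝ => (t, x)))
    · refine intervalIntegrable_of_bound (C := C * B) (measurable_integral_unitMeasure
        (f := fun z : ℝ × ℝ => p (z.1 + z.2) * φ.box z.1 z.2)
        ((h1.comp (by fun_prop)).mul hbc.measurable)) hs.1 fun t ht => ?_
      exact abs_integral_unitMeasure_le fun x hx =>
        abs_mul_le_of_le (hC _) (hB t ⟨ht.1.le, ht.2⟩ x ⟨hx.1.le, hx.2.le⟩)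
    · refine intervalIntegrable_of_bound (C := D * B) (measurable_integral_unitMeasure
        (f := fun z : ℝ × ℝ => q (z.1 + (1 - z.2)) * φ.box z.1 z.2)
        ((h2.comp (by fun_prop)).mul hbc.measurable)) hs.1 fun t ht => ?_
      exact abs_integral_unitMeasure_le fun x hx =>
        abs_mul_le_of_le (hD _) (hB t ⟨ht.1.le, ht.2⟩ x ⟨hx.1.le, hx.2.le⟩)
  have hbdry : ∫ t in (0 : ℝ)..s, (u₁ t * φ.dx t 1 - u₀ t * φ.dx t 0) =
      (∫ t in (0 : ℝ)..s, (p (t + 1) * φ.dx t 1 - p t * φ.dx t 0))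
        + ∫ t in (0 : ℝ)..s, (q t * φ.dx t 1 - q (t + 1) * φ.dx t 0) := by
    have hii : ∀ {f : ℝ → ℝ} {M : ℝ} (x : ℝ), x ∈ Icc (0 : ℝ) 1 → Measurable f →
        (∀ z, |f z| ≤ M) → IntervalIntegrable (fun t => f t * φ.dx t x) volume 0 s :=
      fun x hx hf hM => intervalIntegrable_of_bound (hf.mul (hdxm x)) hs.1 fun t ht =>
        abs_mul_le_of_le (hM t) (hB' t ⟨ht.1.le, ht.2⟩ x hx)
    rw [← intervalIntegral.integral_add
      ((hii 1 (by simp) (by fun_prop) (fun z => hC (z + 1))).sub (hii 0 (by simp) h1 hC))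
      ((hii 1 (by simp) h2 hD).sub (hii 0 (by simp) (by fun_prop) (fun z => hD (z + 1))))]
    -- The controls are prescribed on the open interval `(0, T)` only, so the endpoint is removed
    -- first. With step profiles the traces differ from the controls at `t = 0` in general.
    rw [intervalIntegral.integral_of_le hs.1, intervalIntegral.integral_of_le hs.1,
      integral_Ioc_eq_integral_Ioo, integral_Ioc_eq_integral_Ioo]
    refine setIntegral_congr_fun measurableSet_Ioo fun t ht => ?_
    have ht' : t ∈ Ioo 0 T := ⟨ht.1, ht.2.trans_le hs.2⟩
    simp only [hu₀ t ht', hu₁ t ht']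
    ring
  have tp := hp.transport φ s hs.1
  unfold TransportIdentity at tp
  rw [hlhs, hbdry, hp.energy_pairing hq, hp.energy_pairing hq, tp,
    (hq.transport φ.reflect s hs.1).reflect]
  ring

/-! ### Steering constant states -/

/-- The continuous profile equal to `c₀` up to `1`, affine on `[1,T]`, and equal to `c₁` from `T`
on. -/
def rampProfile (T c₀ c₁ z : ℝ) : ℝ := c₀ + (c₁ - c₀) * max 0 (min 1 ((z - 1) / (T - 1)))

theorem continuous_rampProfile (T c₀ c₁ : ℝ) : Continuous (rampProfile T c₀ c₁) := by
  unfold rampProfile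
  fun_prop

theorem isProfile_rampProfile (T c₀ c₁ : ℝ) : IsProfile (rampProfile T c₀ c₁) := by
  refine .of_continuous (continuous_rampProfile T c₀ c₁) ⟨|c₀| + |c₁ - c₀|, fun z => ?_⟩
  refine (abs_add_le _ _).trans (add_le_add_right ?_ _)
  rw [abs_mul, abs_of_nonneg (le_max_left 0 (min 1 ((z - 1) / (T - 1))))]
  exact mul_le_of_le_one_right (abs_nonneg _) (max_le zero_le_one (min_le_left _ _))

theorem rampProfile_nonneg {c₀ c₁ : ℝ} (h₀ : 0 ≤ c₀) (h₁ : 0 ≤ c₁) (T z : ℝ) :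
    0 ≤ rampProfile T c₀ c₁ z := by
  unfold rampProfile
  have h2 : max 0 (min 1 ((z - 1) / (T - 1))) ≤ 1 := max_le zero_le_one (min_le_left _ _)
  have h3 := le_max_left 0 (min 1 ((z - 1) / (T - 1)))
  nlinarith

theorem rampProfile_of_le_one {T z : ℝ} (hT : 1 < T) (hz : z ≤ 1) (c₀ c₁ : ℝ) :
    rampProfile T c₀ c₁ z = c₀ := by
  have : (z - 1) / (T - 1) ≤ 0 := div_nonpos_of_nonpos_of_nonneg (by linarith) (by linarith)
  simp [rampProfile, max_eq_left ((min_le_right 1 _).trans this)]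

theorem rampProfile_of_ge {T z : ℝ} (hT : 1 < T) (hz : T ≤ z) (c₀ c₁ : ℝ) :
    rampProfile T c₀ c₁ z = c₁ := by
  have : 1 ≤ (z - 1) / (T - 1) := by
    rw [le_div_iff₀ (by linarith)]; linarith
  simp [rampProfile, min_eq_left this]

theorem rampProfile_of_mem {T z : ℝ} (hT : 1 < T) (hz : z ∈ Icc 1 T) (c₀ c₁ : ℝ) :
    rampProfile T c₀ c₁ z = (c₁ - c₀) * ((z - 1) / (T - 1)) + c₀ := by
  have h1 : 0 ≤ (z - 1) / (T - 1) := div_nonneg (by linarith [hz.1]) (by linarith)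
  have h2 : (z - 1) / (T - 1) ≤ 1 := by
    rw [div_le_iff₀ (by linarith)]; linarith [hz.2]
  rw [rampProfile, min_eq_right h2, max_eq_right h1, add_comm]

theorem ramp₀_eq {T t : ℝ} (hT : 1 < T) (ht : t ∈ Icc 0 T) (c₀ c₁ : ℝ) :
    ramp₀ T c₀ c₁ t = rampProfile T c₀ c₁ t := by
  unfold ramp₀
  split_ifs with h
  · exact (rampProfile_of_le_one hT h.le c₀ c₁).symm
  · exact (rampProfile_of_mem hT ⟨not_lt.1 h, ht.2⟩ c₀ c₁).symm

theorem ramp₁_eq {T t : ℝ} (hT : 1 < T) (ht : t ∈ Icc 0 T) (c₀ c₁ : ℝ) :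
    ramp₁ T c₀ c₁ t = rampProfile T c₀ c₁ (t + 1) := by
  unfold ramp₁
  split_ifs with h
  · rw [rampProfile_of_mem hT ⟨by linarith [ht.1], by linarith⟩, add_sub_cancel_right]
  · exact (rampProfile_of_ge hT (by linarith) c₀ c₁).symm

/-- A single left-going wave: `u₁` feeds in `p(t + 1)` at `x = 1`, and `u₀` equals the outgoing
value `p(t)` at `x = 0`, so nothing is reflected. The profile is `c₀` on the initial window and `c₁`
on the final one. -/
theorem exists_solution_ramp {T c₀ c₁ : ℝ} (h₀ : 0 ≤ c₀) (h₁ : 0 ≤ c₁) (hT : 1 < T) :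
    ∃ y v, IsUniqueSolution T (constState c₀) 0 (ramp₀ T c₀ c₁) (ramp₁ T c₀ c₁) y v ∧
      y T = constState c₁ ∧ v T = 0 ∧
      ∃ Y : ℝ → ℝ → ℝ,
        ContinuousOn (fun p : ℝ × ℝ => Y p.1 p.2) (Icc 0 T ×ˢ Icc 0 1) ∧
        (∀ t ∈ Icc 0 T, y t =ᵐ[unitMeasure] Y t) ∧
        ∀ t ∈ Icc 0 T, ∀ x ∈ Icc (0 : ℝ) 1, 0 ≤ Y t x := by
  have hp := isProfile_rampProfile T c₀ c₁
  have hq : IsProfile fun _ => (0 : ℝ) := .of_continuous continuous_const ⟨0, fun _ => by simp⟩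
  have hend : ∀ x ∈ Ioo (0 : ℝ) 1, rampProfile T c₀ c₁ (T + x) = c₁ := fun x hx =>
    rampProfile_of_ge hT (by linarith [hx.1]) c₀ c₁
  refine ⟨hp.state hq, hp.velocity hq, ?_, hp.state_eq_const hq hend (fun _ _ => rfl) (add_zero _),
    hp.velocity_eq_zero hq hend (fun _ _ => rfl), fun t x => rampProfile T c₀ c₁ (t + x), ?_, ?_,
    fun t _ x _ => rampProfile_nonneg h₀ h₁ T _⟩
  · refine (hp.isSolution hq (fun x hx => rampProfile_of_le_one hT hx.2.le c₀ c₁)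
      (fun _ _ => rfl) (add_zero _) (fun t ht => ?_) (fun t ht => ?_)).isUniqueSolution
    · rw [add_zero, ramp₀_eq hT ⟨ht.1.le, ht.2.le⟩]
    · rw [add_zero, ramp₁_eq hT ⟨ht.1.le, ht.2.le⟩]
  · exact ((continuous_rampProfile T c₀ c₁).comp (by fun_prop)).continuousOn
  · intro t _
    filter_upwards [hp.state_ae hq t] with x hx
    rw [hx, add_zero]

/-- The share `1 - l` of the jump from `c₀` to `c₁` travels left and the share `l` travels right.
Each front crosses the interval in time exactly `1`. Until then each end sees the old value of the
outgoing share and the new value of the incoming one, whence constant controls. -/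
theorem exists_solution_const {c₀ c₁ l : ℝ} (h₀ : 0 ≤ c₀) (h₁ : 0 ≤ c₁) (hl : l ∈ Icc (0 : ℝ) 1) :
    ∃ y v, IsUniqueSolution 1 (constState c₀) 0
        (fun _ => (1 - l) * c₀ + l * c₁) (fun _ => (1 - l) * c₁ + l * c₀) y v ∧
      y 1 = constState c₁ ∧ v 1 = 0 ∧ NonnegState 1 y := by
  have hl' : 0 ≤ 1 - l := by linarith [hl.2]
  have hp := isProfile_step ((1 - l) * c₀) ((1 - l) * c₁)
  have hq := isProfile_step (l * c₀) (l * c₁)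
  have hle : ∀ a b z : ℝ, z ≤ 1 → step a b z = a := fun a b z hz => if_pos hz
  have hgt : ∀ a b z : ℝ, 0 < z → step a b (z + 1) = b := fun a b z hz =>
    if_neg (by linarith)
  have hend : ∀ a b : ℝ, ∀ x ∈ Ioo (0 : ℝ) 1, step a b (1 + x) = b := fun a b x hx => by
    rw [add_comm, hgt a b x hx.1]
  have hnn : ∀ a b : ℝ, 0 ≤ a → 0 ≤ b → ∀ z, 0 ≤ step a b z := fun a b ha hb z => by
    unfold step
    split_ifs <;> assumption
  refine ⟨hp.state hq, hp.velocity hq, ?_, hp.state_eq_const hq (hend _ _) (hend _ _) (by ring),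
    hp.velocity_eq_zero hq (hend _ _) (hend _ _), fun t _ => ?_⟩
  · refine (hp.isSolution hq (fun x hx => hle _ _ x hx.2.le) (fun x hx => hle _ _ x hx.2.le)
      (by ring) (fun t ht => ?_) (fun t ht => ?_)).isUniqueSolution
    · rw [hle _ _ t ht.2.le, hgt _ _ t ht.1]
    · rw [hle _ _ t ht.2.le, hgt _ _ t ht.1]
  · filter_upwards [hp.state_ae hq t] with x hx
    rw [hx]
    exact add_nonneg (hnn _ _ (mul_nonneg hl' h₀) (mul_nonneg hl' h₁) _)
      (hnn _ _ (mul_nonneg hl.1 h₀) (mul_nonneg hl.1 h₁) _)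

end WaveControl

end

/-! ### The main theorem. -/

theorem mainTheorem8 (c₀ c₁ : ℝ) (h₀ : 0 ≤ c₀) (h₁ : 0 ≤ c₁) :
    -- explicit nonnegative controls and nonnegative solution in every time `T > 1`
    (∀ T : ℝ, 1 < T →
      (∀ t ∈ Set.Icc 0 T, 0 ≤ WaveControl.ramp₀ T c₀ c₁ t ∧ 0 ≤ WaveControl.ramp₁ T c₀ c₁ t) ∧
      ∃ y v, WaveControl.IsUniqueSolution T (WaveControl.constState c₀) 0
          (WaveControl.ramp₀ T c₀ c₁) (WaveControl.ramp₁ T c₀ c₁) y v ∧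
        y T = WaveControl.constState c₁ ∧ v T = 0 ∧
        ∃ Y : ℝ → ℝ → ℝ,
          ContinuousOn (fun p : ℝ × ℝ => Y p.1 p.2) (Set.Icc 0 T ×ˢ Set.Icc 0 1) ∧
          (∀ t ∈ Set.Icc 0 T, y t =ᵐ[WaveControl.unitMeasure] Y t) ∧
          ∀ t ∈ Set.Icc 0 T, ∀ x ∈ Set.Icc (0 : ℝ) 1, 0 ≤ Y t x) ∧
    -- the three minimal times
    (c₀ ≠ c₁ →
      WaveControl.minTimeState (WaveControl.constState c₀) 0 (WaveControl.constState c₁) 0 = 1 ∧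
      WaveControl.minTimeControl (WaveControl.constState c₀) 0 (WaveControl.constState c₁) 0 = 1 ∧
      WaveControl.minTime (WaveControl.constState c₀) 0 (WaveControl.constState c₁) 0 = 1) ∧
    -- constant controls in time `1`
    (∃ y v, WaveControl.IsUniqueSolution 1 (WaveControl.constState c₀) 0
        (fun _ => c₀) (fun _ => c₁) y v ∧
      y 1 = WaveControl.constState c₁ ∧ v 1 = 0 ∧ WaveControl.NonnegState 1 y) ∧
    -- a one-parameter family of nonnegative controls in time `1`
    (∀ l ∈ Set.Icc (0 : ℝ) 1,
      0 ≤ (1 - l) * c₀ + l * c₁ ∧ 0 ≤ (1 - l) * c₁ + l * c₀ ∧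
      ∃ y v, WaveControl.IsUniqueSolution 1 (WaveControl.constState c₀) 0
          (fun _ => (1 - l) * c₀ + l * c₁) (fun _ => (1 - l) * c₁ + l * c₀) y v ∧
        y 1 = WaveControl.constState c₁ ∧ v 1 = 0) ∧
    -- non-uniqueness of the controls in time `1`, even with all the constraints
    (c₀ ≠ c₁ → ∃ u₀ u₁ w₀ w₁ : ℝ → ℝ,
      (WaveControl.NonnegControl 1 u₀ ∧ WaveControl.NonnegControl 1 u₁ ∧
        ∃ y v, WaveControl.IsUniqueSolution 1 (WaveControl.constState c₀) 0 u₀ u₁ y v ∧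
          y 1 = WaveControl.constState c₁ ∧ v 1 = 0 ∧ WaveControl.NonnegState 1 y) ∧
      (WaveControl.NonnegControl 1 w₀ ∧ WaveControl.NonnegControl 1 w₁ ∧
        ∃ y v, WaveControl.IsUniqueSolution 1 (WaveControl.constState c₀) 0 w₀ w₁ y v ∧
          y 1 = WaveControl.constState c₁ ∧ v 1 = 0 ∧ WaveControl.NonnegState 1 y) ∧
      ¬ (u₀ =ᵐ[MeasureTheory.volume.restrict (Set.Ioo 0 1)] w₀ ∧
          u₁ =ᵐ[MeasureTheory.volume.restrict (Set.Ioo 0 1)] w₁)) := by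
  refine ⟨fun T hT => ⟨fun t ht => ?_, WaveControl.exists_solution_ramp h₀ h₁ hT⟩, fun hne => ?_,
    ?_, fun l hl => ?_, fun hne => ?_⟩
  · rw [WaveControl.ramp₀_eq hT ht, WaveControl.ramp₁_eq hT ht]
    exact ⟨WaveControl.rampProfile_nonneg h₀ h₁ T _, WaveControl.rampProfile_nonneg h₀ h₁ T _⟩
  -- The solution with `l = 0` meets all constraints, so time `1` is attained in each of the three
  -- sets. The unconstrained lower bound `hge` serves for all of them.
  · obtain ⟨y, v, hu, hy, hv, hn⟩ :=
      WaveControl.exists_solution_const h₀ h₁ (l := 0) ⟨le_rfl, zero_le_one⟩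
    have hge : ∀ {T : ℝ} {u₀ u₁ y v}, 0 < T →
        WaveControl.IsSolution T (WaveControl.constState c₀) 0 u₀ u₁ y v →
        y T = WaveControl.constState c₁ → v T = 0 → 1 ≤ T := fun h0 hs hy hv => by
      by_contra hlt
      exact hne (WaveControl.eq_of_steers_of_lt_one h0 (not_le.1 hlt) hs hy hv)
    have n₀ : WaveControl.NonnegControl 1 (fun _ => (1 - 0) * c₀ + 0 * c₁) :=
      Filter.Eventually.of_forall fun _ => by simpa using h₀
    have n₁ : WaveControl.NonnegControl 1 (fun _ => (1 - 0) * c₁ + 0 * c₀) :=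
      Filter.Eventually.of_forall fun _ => by simpa using h₁
    refine ⟨IsLeast.csInf_eq ⟨⟨one_pos, _, _, y, v, n₀, n₁, hu.1, hy, hv, hn⟩, ?_⟩,
      IsLeast.csInf_eq ⟨⟨one_pos, _, _, y, v, n₀, n₁, hu.1, hy, hv⟩, ?_⟩,
      IsLeast.csInf_eq ⟨⟨one_pos, _, _, y, v, hu.1, hy, hv⟩, ?_⟩⟩
    · rintro T ⟨h0, u₀, u₁, y, v, -, -, hs, hy, hv, -⟩
      exact hge h0 hs hy hv
    · rintro T ⟨h0, u₀, u₁, y, v, -, -, hs, hy, hv⟩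
      exact hge h0 hs hy hv
    · rintro T ⟨h0, u₀, u₁, y, v, hs, hy, hv⟩
      exact hge h0 hs hy hv
  · simpa using WaveControl.exists_solution_const h₀ h₁ (l := 0) ⟨le_rfl, zero_le_one⟩
  · obtain ⟨y, v, hu, hy, hv, -⟩ := WaveControl.exists_solution_const h₀ h₁ hl
    have hl' : 0 ≤ 1 - l := by linarith [hl.2]
    have hl0 : 0 ≤ l := hl.1
    exact ⟨by positivity, by positivity, y, v, hu, hy, hv⟩
  -- The extreme cases `l = 0` and `l = 1` use one front only and exchange the two controls.
  · refine ⟨fun _ => c₀, fun _ => c₁, fun _ => c₁, fun _ => c₀,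
      ⟨Filter.Eventually.of_forall fun _ => h₀, Filter.Eventually.of_forall fun _ => h₁, ?_⟩,
      ⟨Filter.Eventually.of_forall fun _ => h₁, Filter.Eventually.of_forall fun _ => h₀, ?_⟩, ?_⟩
    · simpa using WaveControl.exists_solution_const h₀ h₁ (l := 0) ⟨le_rfl, zero_le_one⟩
    · simpa using WaveControl.exists_solution_const h₀ h₁ (l := 1) ⟨zero_le_one, le_rfl⟩
    · rintro ⟨h, -⟩
      -- On a nonzero measure, almost everywhere equality of the constants `c₀` and `c₁` holds at
      -- some point, hence forces `c₀ = c₁`.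
      have hne0 : MeasureTheory.volume.restrict (Set.Ioo (0 : ℝ) 1) ≠ 0 := by
        rw [Ne, MeasureTheory.Measure.restrict_eq_zero]
        simp
      have : (MeasureTheory.ae (MeasureTheory.volume.restrict (Set.Ioo (0 : ℝ) 1))).NeBot :=
        MeasureTheory.ae_neBot.2 hne0
      obtain ⟨t, ht⟩ := h.exists
      exact hne ht
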